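/- Let $0<\rho<1$ and $a>b>0$ be constants, $T=\log(a/b)$, and for each $n$ let $K$ be $\rho n/\log n$ rounded to an integer (up or down), $p=a\log^2 n/n$, $q=b\log^2 n/n$ ($n$ large). A community $C^*$ is uniformly distributed among the $K$-element subsets of $\{1,\dots,n\}$. Given $C^*$, a random graph $G$ on $\{1,\dots,n\}$ joins each pair of nodes independently, with probability $p$ if both nodes lie in $C^*$ and $q$ otherwise. Independently of $G$ given $C^*$, every node $i$ carries features $y_{i,1},\dots,y_{i,M}$, with $M$ not depending on $n$. All $y_{i,m}$ are independent given $C^*$; feature $m$ takes values in a finite alphabet of size $L_m$ not depending on $n$, and takes its $\ell$-th value with probability $\alpha^m_{+,\ell}(n)$ if $i\in C^*$ and $\alpha^m_{-,\ell}(n)$ if $i\notin C^*$. All these likelihoods are monotonic (possibly constant) in $n$. Exact recovery is achieved if there are estimators $\hat C_n(G,Y)$, where $Y=(y_{i,m})$, with $\mathbb P(\hat C_n=C^*)\to1$ as $n\to\infty$. Put $$\eta_1=\rho\Big(b+\tfrac{a-b}{T}\log\tfrac{a-b}{ebT}\Big),\qquad \eta_2(\beta)=\rho b+\tfrac{\rho(a-b)-\beta}{T}\log\tfrac{\rho(a-b)-\beta}{\rho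 ebT}+\beta,\qquad \eta_3(\beta)=\rho b+\tfrac{\rho(a-b)+\beta}{T}\log\tfrac{\rho(a-b)+\beta}{\rho ebT},$$ and $\beta_{\max}=\rho(a-b-bT)$. For a sequence (over $n$) of outcomes $[\ell_1,\dots,\ell_M]$ whose likelihoods are positive for large $n$, put $f_1(n)=\sum_m\log(\alpha^m_{+,\ell_m}/\alpha^m_{-,\ell_m})$, $f_2(n)=\sum_m\log\alpha^m_{+,\ell_m}$, $f_3(n)=\sum_m\log\alpha^m_{-,\ell_m}$. Attach to the sequence a threshold in the following cases: 1. $f_1,f_2,f_3=o(\log n)$: threshold $\eta_1$; 2. $f_1=o(\log n)$ and $f_2,f_3=-\beta\log n+o(\log n)$ with $\beta>0$: threshold $\eta_1+\beta$; 3. $f_1=\beta_1\log n+o(\log n)$ with $0<\beta_1<\beta_{\max}$, and $f_2=o(\log n)$: threshold $\eta_2(\beta_1)$; 4. $f_1=-\beta_2\log n+o(\log n)$ with $0<\beta_2<\beta_{\max}$, and $f_3=o(\log n)$: threshold $\eta_3(\beta_2)$; 5. $f_1=\beta_3\log n+o(\log n)$ with $0<\beta_3<\beta_{\max}$, and $f_2=-\beta_3'\log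 n+o(\log n)$: threshold $\eta_2(\beta_3)+\beta_3'$; 6. $f_1=-\beta_4\log n+o(\log n)$ with $0<\beta_4<\beta_{\max}$, and $f_3=-\beta_4'\log n+o(\log n)$: threshold $\eta_3(\beta_4)+\beta_4'$. Then: (Necessity) If exact recovery is achieved, every threshold attached to a sequence of outcomes is at least $1$. (Sufficiency) Suppose that every fixed outcome $[\ell_1,\dots,\ell_M]$, regarded as a constant sequence, either falls under one of the cases 1-6 or satisfies $\min\big(\prod_m\alpha^m_{+,\ell_m},\prod_m\alpha^m_{-,\ell_m}\big)=n^{-\omega(1)}$ (it may be $0$; this includes $|f_1|=\omega(\log n)$). If every threshold attached to a sequence of outcomes exceeds $1$, then exact recovery is achieved. In particular, under the assumption on the outcomes made in the second part, and if no attached threshold equals exactly $1$, exact recovery is achieved if and only if all attached thresholds exceed $1$. -/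

import Mathlib

open Filter Topology

/-- A side-information outcome of one node: one letter for each of the `M` features, the alphabet
of feature `m` having `L m` letters. -/
abbrev Outcome {M : ℕ} (L : Fin M → ℕ) : Type := (m : Fin M) → Fin (L m)

/-- The likelihoods of `M` finite-alphabet features, as functions of the number `n` of nodes.
`inside n m u` is the probability that feature `m` of a node of the community takes the value `u`,
and `outside n m u` is the same probability for a node outside the community. Every likelihood is
monotonic (possibly constant) in `n`. -/
structure Features {M : ℕ} (L : Fin M → ℕ) where
  inside : ℕ → (m : Fin M) → Fin (L m) → ℝ
  outside : ℕ → (m : Fin M) → Fin (L m) → ℝ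
  inside_nonneg : ∀ n m u, 0 ≤ inside n m u
  outside_nonneg : ∀ n m u, 0 ≤ outside n m u
  inside_sum : ∀ n m, ∑ u, inside n m u = 1
  outside_sum : ∀ n m, ∑ u, outside n m u = 1
  inside_mono : ∀ m u, Monotone (fun n => inside n m u) ∨ Antitone (fun n => inside n m u)
  outside_mono : ∀ m u, Monotone (fun n => outside n m u) ∨ Antitone (fun n => outside n m u)

/-! ### The hidden community model -/

open Classical in
/-- Probability of the graph `G` on `n` nodes when the community is `C`: the pairs `i < j` are
independent, and joined with probability `p` if both ends lie in `C` and `q` otherwise. -/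
noncomputable def graphProb {n : ℕ} (p q : ℝ) (C : Finset (Fin n)) (G : SimpleGraph (Fin n)) : ℝ :=
  ∏ e ∈ (Finset.univ : Finset (Fin n × Fin n)).filter (fun e => e.1 < e.2),
    let r := if e.1 ∈ C ∧ e.2 ∈ C then p else q
    if G.Adj e.1 e.2 then r else 1 - r

/-- Probability of the side-information matrix `Y` on `n` nodes when the community is `C`: given
the labels all entries are independent. -/
noncomputable def sideProb {M : ℕ} {L : Fin M → ℕ} (F : Features L) {n : ℕ} (C : Finset (Fin n))
    (Y : Fin n → Outcome L) : ℝ :=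
  ∏ i, ∏ m, if i ∈ C then F.inside n m (Y i m) else F.outside n m (Y i m)

/-- An estimator of the community (equivalently of the label vector) from graph and side
information on `n` nodes. -/
abbrev Estimator {M : ℕ} (L : Fin M → ℕ) (n : ℕ) : Type :=
  SimpleGraph (Fin n) → (Fin n → Outcome L) → Finset (Fin n)

open Classical in
/-- Probability that the estimator returns exactly the community, when the community is uniform
among the `K`-element sets of nodes and, given the community, graph and side information are
independent and distributed as above. -/
noncomputable def successProb {M : ℕ} {L : Fin M → ℕ} (F : Features L) (n K : ℕ) (p q : ℝ)
    (est : Estimator L n) : ℝ :=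
  (∑ C ∈ Finset.powersetCard K (Finset.univ : Finset (Fin n)),
    ∑ G : SimpleGraph (Fin n), ∑ Y : Fin n → Outcome L,
      if est G Y = C then graphProb p q C G * sideProb F C Y else 0) / (n.choose K : ℝ)

/-- Exact recovery is achieved (by some sequence of estimators) for the model with community size
`K n` and edge probabilities `p n`, `q n`. -/
def ExactRecovery {M : ℕ} {L : Fin M → ℕ} (F : Features L) (K : ℕ → ℕ) (p q : ℕ → ℝ) : Prop :=
  ∃ est : (n : ℕ) → Estimator L n,
    Tendsto (fun n => successProb F n (K n) (p n) (q n) (est n)) atTop (𝓝 1)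

/-! ### Threshold functions -/

noncomputable def eta1 (ρ a b : ℝ) : ℝ :=
  ρ * (b + (a - b) / Real.log (a / b) *
    Real.log ((a - b) / (Real.exp 1 * b * Real.log (a / b))))

noncomputable def eta2 (ρ a b β : ℝ) : ℝ :=
  ρ * b + (ρ * (a - b) - β) / Real.log (a / b) *
    Real.log ((ρ * (a - b) - β) / (ρ * Real.exp 1 * b * Real.log (a / b))) + β

noncomputable def eta3 (ρ a b β : ℝ) : ℝ :=
  ρ * b + (ρ * (a - b) + β) / Real.log (a / b) *
    Real.log ((ρ * (a - b) + β) / (ρ * Real.exp 1 * b * Real.log (a / b)))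

/-- `ρ (a - b - b T)` with `T = log (a / b)`, the bound on the `log n`-coefficient of the summed
log-likelihood ratio. -/
noncomputable def betaMax (ρ a b : ℝ) : ℝ := ρ * (a - b - b * Real.log (a / b))

/-! ### Sequences of outcomes -/

/-- The summed log-likelihood ratio along a sequence (over `n`) of outcomes. -/
noncomputable def f1 {M : ℕ} {L : Fin M → ℕ} (F : Features L) (l : ℕ → Outcome L) (n : ℕ) : ℝ :=
  ∑ m, Real.log (F.inside n m (l n m) / F.outside n m (l n m))

/-- The log-likelihood inside the community along a sequence of outcomes. -/
noncomputable def f2 {M : ℕ} {L : Fin M → ℕ} (F : Features L) (l : ℕ → Outcome L) (n : ℕ) : ℝ :=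
  ∑ m, Real.log (F.inside n m (l n m))

/-- The log-likelihood outside the community along a sequence of outcomes. -/
noncomputable def f3 {M : ℕ} {L : Fin M → ℕ} (F : Features L) (l : ℕ → Outcome L) (n : ℕ) : ℝ :=
  ∑ m, Real.log (F.outside n m (l n m))

/-- `f n = c * log n + o(log n)`. -/
def LogScale (f : ℕ → ℝ) (c : ℝ) : Prop :=
  Asymptotics.IsLittleO atTop (fun n : ℕ => f n - c * Real.log (n : ℝ))
    (fun n : ℕ => Real.log (n : ℝ))

/-- The likelihoods along the sequence of outcomes are positive for large `n`, so that `f1`, `f2`,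
`f3` are finite there and not affected by the convention `Real.log 0 = 0`. -/
def EventuallyPositive {M : ℕ} {L : Fin M → ℕ} (F : Features L) (l : ℕ → Outcome L) : Prop :=
  ∀ᶠ n in atTop, ∀ m, 0 < F.inside n m (l n m) ∧ 0 < F.outside n m (l n m)

/-- `OutcomeThreshold F ρ a b l τ`: the sequence of outcomes `l` falls under one of the six cases,
and the threshold attached to it by that case is `τ`. -/
inductive OutcomeThreshold {M : ℕ} {L : Fin M → ℕ} (F : Features L) (ρ a b : ℝ)
    (l : ℕ → Outcome L) : ℝ → Prop
  | case1 (hpos : EventuallyPositive F l)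
      (h1 : LogScale (f1 F l) 0) (h2 : LogScale (f2 F l) 0) (h3 : LogScale (f3 F l) 0) :
      OutcomeThreshold F ρ a b l (eta1 ρ a b)
  | case2 (hpos : EventuallyPositive F l) (β : ℝ) (hβ : 0 < β)
      (h1 : LogScale (f1 F l) 0) (h2 : LogScale (f2 F l) (-β)) (h3 : LogScale (f3 F l) (-β)) :
      OutcomeThreshold F ρ a b l (eta1 ρ a b + β)
  | case3 (hpos : EventuallyPositive F l) (β : ℝ) (hβ : 0 < β) (hβ_lt : β < betaMax ρ a b)
      (h1 : LogScale (f1 F l) β) (h2 : LogScale (f2 F l) 0) :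
      OutcomeThreshold F ρ a b l (eta2 ρ a b β)
  | case4 (hpos : EventuallyPositive F l) (β : ℝ) (hβ : 0 < β) (hβ_lt : β < betaMax ρ a b)
      (h1 : LogScale (f1 F l) (-β)) (h3 : LogScale (f3 F l) 0) :
      OutcomeThreshold F ρ a b l (eta3 ρ a b β)
  | case5 (hpos : EventuallyPositive F l) (β β' : ℝ) (hβ : 0 < β) (hβ_lt : β < betaMax ρ a b)
      (h1 : LogScale (f1 F l) β) (h2 : LogScale (f2 F l) (-β')) :
      OutcomeThreshold F ρ a b l (eta2 ρ a b β + β')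
  | case6 (hpos : EventuallyPositive F l) (β β' : ℝ) (hβ : 0 < β) (hβ_lt : β < betaMax ρ a b)
      (h1 : LogScale (f1 F l) (-β)) (h3 : LogScale (f3 F l) (-β')) :
      OutcomeThreshold F ρ a b l (eta3 ρ a b β + β')

/-- The outcome `o` has, under at least one of the two labels, a probability smaller than every
power of `n`, possibly zero. This includes every outcome whose log-likelihood ratio is infinite or
of larger order than `log n`. -/
def SuperpolynomiallyRare {M : ℕ} {L : Fin M → ℕ} (F : Features L) (o : Outcome L) : Prop :=
  ∀ B : ℝ, ∀ᶠ n : ℕ in atTop,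
    min (∏ m, F.inside n m (o m)) (∏ m, F.outside n m (o m)) ≤ (n : ℝ) ^ (-B)

/-- Every single outcome falls under one of the six cases or is superpolynomially rare under one of
the labels. What remains outside is a summed log-likelihood ratio of exact order `log n` with
coefficient at least `betaMax ρ a b` in absolute value, and likelihoods without a regular
behaviour on the `log n` scale. -/
def OutcomesClassified {M : ℕ} {L : Fin M → ℕ} (F : Features L) (ρ a b : ℝ) : Prop :=
  ∀ o : Outcome L,
    (∃ τ, OutcomeThreshold F ρ a b (fun _ => o) τ) ∨ SuperpolynomiallyRare F o

/-! Both directions turn on the number of neighbours a node has in the community. On the scale `log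
n` this degree is Poisson with mean `ρ a` at a community node and `ρ b` elsewhere. Since `K =
n^(1-o(1))`, both labels have `n^(1-o(1))` nodes. For an outcome whose log-likelihood ratio is `γ
log n + o(log n)`, take `t = (ρ (a - b) - γ) / T`. At this `t` two exponents agree: that of a
community node having the outcome and degree about `t log n`, and that of an outside node having
them. Their common value is the attached threshold (`OutcomeThreshold.exists_rate`), so all six
cases are one computation.

Necessity: if the threshold is below `1`, a second-moment argument finds, with probability bounded
below, a community node of degree at most `s₁ log n` and an outside node of degree at least `s₂ log
n`, both with this outcome, where `s₁ < t < s₂`. Exchanging them does not lower the likelihood, so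
any correct guess is matched by an error at least as likely (`successProb_le_of_swappable`), and
success stays below `3/4`.

Sufficiency: the estimator returns any `K`-set in which every node passes a test. For a regular
outcome, members need degree at least `(t + ε) log n` and the others at most `(t - ε) log n`; for a
rare outcome the likelier label decides. Thresholds above `1` let the true community pass, by
Chernoff and union bounds. A wrong set `D` that also passes would force `D \ C` to be unusually
dense, and joined unusually densely to `D`. The first is excluded when `D \ C` is small and the
second when it is a fixed fraction of `K` (`LogRegime.uniqueness`). -/

/-! ### Finite weighted probability: union bound, Markov, Chebyshev, independence. -/

section FiniteProbability

open Classical in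
/-- Total weight of the points of a finite weighted set that satisfy a predicate. -/
noncomputable def wprob {Ω : Type*} [Fintype Ω] (w : Ω → ℝ) (A : Ω → Prop) : ℝ :=
  ∑ ω, if A ω then w ω else 0

variable {Ω : Type*} [Fintype Ω] {w : Ω → ℝ} {A B : Ω → Prop}

theorem wprob_nonneg (hw : ∀ ω, 0 ≤ w ω) : 0 ≤ wprob w A :=
  Finset.sum_nonneg fun ω _ => by split_ifs <;> simp [hw]

theorem wprob_mono (hw : ∀ ω, 0 ≤ w ω) (h : ∀ ω, A ω → B ω) : wprob w A ≤ wprob w B := by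
  refine Finset.sum_le_sum fun ω _ => ?_
  by_cases hA : A ω
  · simp [hA, h ω hA]
  · simp only [hA, if_false]
    split_ifs <;> simp [hw]

theorem wprob_congr (h : ∀ ω, A ω ↔ B ω) : wprob w A = wprob w B := by
  rw [show A = B from funext fun ω => propext (h ω)]

theorem wprob_true : wprob w (fun _ => True) = ∑ ω, w ω := by simp [wprob]

theorem wprob_not : wprob w (fun ω => ¬ A ω) = (∑ ω, w ω) - wprob w A := by
  rw [eq_sub_iff_add_eq, wprob, wprob, ← Finset.sum_add_distrib]
  refine Finset.sum_congr rfl fun ω _ => ?_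
  by_cases hA : A ω <;> simp [hA]

theorem wprob_le_one (hw : ∀ ω, 0 ≤ w ω) (h1 : ∑ ω, w ω = 1) : wprob w A ≤ 1 := by
  rw [← h1, ← wprob_true]
  exact wprob_mono hw fun _ _ => trivial

theorem wprob_or_le (hw : ∀ ω, 0 ≤ w ω) :
    wprob w (fun ω => A ω ∨ B ω) ≤ wprob w A + wprob w B := by
  rw [wprob, wprob, wprob, ← Finset.sum_add_distrib]
  refine Finset.sum_le_sum fun ω _ => ?_
  have := hw ω
  by_cases hA : A ω <;> by_cases hB : B ω <;> simp [hA, hB, this]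

theorem wprob_exists_le (hw : ∀ ω, 0 ≤ w ω) {ι : Type*} (s : Finset ι) (A : ι → Ω → Prop) :
    wprob w (fun ω => ∃ i ∈ s, A i ω) ≤ ∑ i ∈ s, wprob w (A i) := by
  classical
  induction s using Finset.induction_on with
  | empty => simp [wprob]
  | insert i s hi ih =>
    rw [Finset.sum_insert hi]
    calc _ = wprob w (fun ω => A i ω ∨ ∃ i ∈ s, A i ω) := wprob_congr fun ω => by simp
      _ ≤ _ := (wprob_or_le hw).trans (by gcongr)

/-- Markov's inequality. -/
theorem wprob_le_sum (hw : ∀ ω, 0 ≤ w ω) {f : Ω → ℝ} (hf : ∀ ω, 0 ≤ f ω)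
    (h : ∀ ω, A ω → 1 ≤ f ω) : wprob w A ≤ ∑ ω, w ω * f ω := by
  refine Finset.sum_le_sum fun ω _ => ?_
  split_ifs with hA
  · exact le_mul_of_one_le_right (hw ω) (h ω hA)
  · exact mul_nonneg (hw ω) (hf ω)

theorem wprob_equiv {Ω' : Type*} [Fintype Ω'] (e : Ω' ≃ Ω) :
    wprob w A = wprob (fun ω => w (e ω)) (fun ω => A (e ω)) := by
  classical
  simp only [wprob]
  exact (Equiv.sum_comp e fun ω => if A ω then w ω else 0).symm

theorem wprob_prod {Ω₁ Ω₂ : Type*} [Fintype Ω₁] [Fintype Ω₂] (w₁ : Ω₁ → ℝ) (w₂ : Ω₂ → ℝ)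
    (A : Ω₁ → Prop) (B : Ω₂ → Prop) :
    wprob (fun ω : Ω₁ × Ω₂ => w₁ ω.1 * w₂ ω.2) (fun ω => A ω.1 ∧ B ω.2) =
      wprob w₁ A * wprob w₂ B := by
  rw [wprob, wprob, wprob, Fintype.sum_prod_type, Finset.sum_mul_sum]
  refine Finset.sum_congr rfl fun x _ => Finset.sum_congr rfl fun y _ => ?_
  by_cases hA : A x <;> by_cases hB : B y <;> simp [hA, hB]

/-- Chebyshev's inequality for the number of events that occur, for nearly uncorrelated events. -/
theorem wprob_forall_not_le (hw : ∀ ω, 0 ≤ w ω) (h1 : ∑ ω, w ω = 1) {ι : Type*} (s : Finset ι)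
    (A : ι → Ω → Prop) {c : ℝ} (hc : 0 ≤ c)
    (hA : ∀ i ∈ s, ∀ j ∈ s, i ≠ j →
      wprob w (fun ω => A i ω ∧ A j ω) ≤ (1 + c) * (wprob w (A i) * wprob w (A j)))
    (hμ : 0 < ∑ i ∈ s, wprob w (A i)) :
    wprob w (fun ω => ∀ i ∈ s, ¬ A i ω) ≤ 1 / (∑ i ∈ s, wprob w (A i)) + c := by
  classical
  set μ := ∑ i ∈ s, wprob w (A i) with hμdef
  let X : Ω → ℝ := fun ω => ∑ i ∈ s, if A i ω then 1 else 0
  have hX1 : ∑ ω, w ω * X ω = μ := by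
    simp only [X, Finset.mul_sum, hμdef, wprob]
    rw [Finset.sum_comm]
    simp
  have hX2 : ∑ ω, w ω * X ω ^ 2 = ∑ i ∈ s, ∑ j ∈ s, wprob w (fun ω => A i ω ∧ A j ω) := by
    simp only [X, sq, Finset.sum_mul_sum, wprob]
    simp only [Finset.mul_sum]
    rw [Finset.sum_comm]
    refine Finset.sum_congr rfl fun i _ => ?_
    rw [Finset.sum_comm]
    refine Finset.sum_congr rfl fun j _ => Finset.sum_congr rfl fun ω _ => ?_
    by_cases hi : A i ω <;> by_cases hj : A j ω <;> simp [hi, hj]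
  have hX2' : ∑ ω, w ω * X ω ^ 2 ≤ μ + (1 + c) * μ ^ 2 := by
    rw [hX2]
    -- The diagonal of the second moment contributes `μ`, all the rest at most `(1 + c) μ ^ 2`;
    -- hence the variance is at most `μ + c μ ^ 2`.
    have : ∀ i ∈ s, ∀ j ∈ s, wprob w (fun ω => A i ω ∧ A j ω) ≤
        (if i = j then wprob w (A i) else 0) + (1 + c) * (wprob w (A i) * wprob w (A j)) := by
      intro i hi j hj
      have hij : 0 ≤ (1 + c) * (wprob w (A i) * wprob w (A j)) :=
        mul_nonneg (by linarith) (mul_nonneg (wprob_nonneg hw) (wprob_nonneg hw))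
      split_ifs with h
      · subst h
        have : wprob w (fun ω => A i ω ∧ A i ω) = wprob w (A i) := wprob_congr fun ω => by simp
        linarith
      · linarith [hA i hi j hj h]
    refine (Finset.sum_le_sum fun i hi => Finset.sum_le_sum fun j hj => this i hi j hj).trans ?_
    simp only [Finset.sum_add_distrib, ← Finset.mul_sum, ← Finset.sum_mul, sq]
    gcongr
    · refine Finset.sum_le_sum fun i hi => ?_
      simp [hi]
  have key : wprob w (fun ω => ∀ i ∈ s, ¬ A i ω) ≤ ∑ ω, w ω * ((X ω - μ) / μ) ^ 2 := by
    refine wprob_le_sum hw (fun ω => sq_nonneg _) fun ω h => ?_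
    have : X ω = 0 := Finset.sum_eq_zero fun i hi => by simp [h i hi]
    rw [this, zero_sub, neg_div, div_self hμ.ne']
    norm_num
  refine key.trans ?_
  have : ∑ ω, w ω * ((X ω - μ) / μ) ^ 2 = (∑ ω, w ω * X ω ^ 2 - μ ^ 2) / μ ^ 2 := by
    have h : ∀ ω, w ω * ((X ω - μ) / μ) ^ 2 =
        (w ω * X ω ^ 2 - 2 * μ * (w ω * X ω) + μ ^ 2 * w ω) / μ ^ 2 := fun ω => by
      field_simp
      ring
    simp_rw [h]
    rw [← Finset.sum_div, Finset.sum_add_distrib, Finset.sum_sub_distrib, ← Finset.mul_sum,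
      ← Finset.mul_sum, hX1, h1]
    ring
  rw [this, div_le_iff₀ (by positivity)]
  have : (1 / μ + c) * μ ^ 2 = μ + c * μ ^ 2 := by field_simp
  rw [this]
  linarith

/-- Independence of disjoint blocks of coordinates under product weights. -/
theorem wprob_pi_and {ι : Type*} [Fintype ι] [DecidableEq ι] {α : ι → Type*} [∀ i, Fintype (α i)]
    (v : ∀ i, α i → ℝ) (hv : ∀ i, ∑ x, v i x = 1) (S : Set ι) {A B : (∀ i, α i) → Prop}
    (hA : ∀ x y, (∀ i ∈ S, x i = y i) → (A x ↔ A y))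
    (hB : ∀ x y, (∀ i ∉ S, x i = y i) → (B x ↔ B y)) :
    wprob (fun x => ∏ i, v i (x i)) (fun x => A x ∧ B x) =
      wprob (fun x => ∏ i, v i (x i)) A * wprob (fun x => ∏ i, v i (x i)) B := by
  classical
  let e := (Equiv.piEquivPiSubtypeProd (· ∈ S) α).symm
  let w₁ : (∀ i : {i // i ∈ S}, α i) → ℝ := fun x => ∏ i : {i // i ∈ S}, v i (x i)
  let w₂ : (∀ i : {i // i ∉ S}, α i) → ℝ := fun x => ∏ i : {i // i ∉ S}, v i (x i)
  have hw : ∀ x, ∏ i, v i (e x i) = w₁ x.1 * w₂ x.2 := by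
    intro x
    rw [← Fintype.prod_subtype_mul_prod_subtype (· ∈ S)]
    congr 1
    · refine Fintype.prod_congr _ _ fun i => ?_
      simp [e, Equiv.piEquivPiSubtypeProd, i.2]
    · refine Fintype.prod_congr _ _ fun i => ?_
      simp [e, Equiv.piEquivPiSubtypeProd, i.2]
  -- As `A` depends only on the block `S`, some extension of a block satisfies `A` exactly when all
  -- extensions do. This turns `A` into an event on the block, without choosing default coordinates.
  let A' : (∀ i : {i // i ∈ S}, α i) → Prop := fun x => ∃ z, (∀ i : {i // i ∈ S}, z i = x i) ∧ A z
  let B' : (∀ i : {i // i ∉ S}, α i) → Prop := fun x => ∃ z, (∀ i : {i // i ∉ S}, z i = x i) ∧ B z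
  have hA' : ∀ x, A (e x) ↔ A' x.1 := by
    intro x
    have hx : ∀ i : {i // i ∈ S}, e x i = x.1 i := fun i => by
      simp [e, Equiv.piEquivPiSubtypeProd, i.2]
    exact ⟨fun h => ⟨e x, hx, h⟩, fun ⟨z, hz, h⟩ =>
      (hA z (e x) fun i hi => (hz ⟨i, hi⟩).trans (hx ⟨i, hi⟩).symm).1 h⟩
  have hB' : ∀ x, B (e x) ↔ B' x.2 := by
    intro x
    have hx : ∀ i : {i // i ∉ S}, e x i = x.2 i := fun i => by
      simp [e, Equiv.piEquivPiSubtypeProd, i.2]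
    exact ⟨fun h => ⟨e x, hx, h⟩, fun ⟨z, hz, h⟩ =>
      (hB z (e x) fun i hi => (hz ⟨i, hi⟩).trans (hx ⟨i, hi⟩).symm).1 h⟩
  have s₁ : ∑ x, w₁ x = 1 := by
    have := Finset.prod_univ_sum (fun i : {i // i ∈ S} => (Finset.univ : Finset (α i)))
      (fun i x => v i x)
    rw [Fintype.piFinset_univ] at this
    rw [← this]
    simp [hv]
  have s₂ : ∑ x, w₂ x = 1 := by
    have := Finset.prod_univ_sum (fun i : {i // i ∉ S} => (Finset.univ : Finset (α i)))
      (fun i x => v i x)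
    rw [Fintype.piFinset_univ] at this
    rw [← this]
    simp [hv]
  have h12 := wprob_prod w₁ w₂ A' B'
  have h1 := wprob_prod w₁ w₂ A' (fun _ => True)
  have h2 := wprob_prod w₁ w₂ (fun _ => True) B'
  rw [wprob_true, s₂, mul_one] at h1
  rw [wprob_true, s₁, one_mul] at h2
  simp only [and_true, true_and] at h1 h2
  rw [wprob_equiv e, wprob_equiv (A := A) e, wprob_equiv (A := B) e]
  simp only [hw, hA', hB']
  rw [h12, h1, h2]

theorem sum_pi_prod {ι : Type*} [Fintype ι] [DecidableEq ι] {α : ι → Type*} [∀ i, Fintype (α i)]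
    (v : ∀ i, α i → ℝ) : ∑ x : ∀ i, α i, ∏ i, v i (x i) = ∏ i, ∑ y, v i y := by
  rw [Finset.prod_univ_sum, Fintype.piFinset_univ]

end FiniteProbability

/-! ### Independent edges, Chernoff bounds and binomial degrees. -/

section RandomGraph

/-- The unordered pairs of distinct nodes, written increasingly. -/
abbrev Edge (n : ℕ) : Type := {e : Fin n × Fin n // e.1 < e.2}

open Classical in
/-- A simple graph as the indicator of its edge set. -/
noncomputable def graphEquiv (n : ℕ) : SimpleGraph (Fin n) ≃ (Edge n → Bool) where
  toFun G e := decide (G.Adj e.1.1 e.1.2)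
  invFun x :=
    { Adj := fun i j => (∃ h : i < j, x ⟨(i, j), h⟩ = true) ∨ ∃ h : j < i, x ⟨(j, i), h⟩ = true
      symm := ⟨fun _ _ h => h.symm⟩
      loopless := ⟨fun i h => by simp at h⟩ }
  left_inv G := by
    ext i j
    rcases lt_trichotomy i j with h | h | h
    · simp [h, h.not_gt]
    · simp [h]
    · simp [h, h.not_gt, G.adj_comm]
  right_inv x := by
    funext e
    obtain ⟨⟨i, j⟩, h⟩ := e
    have h : i < j := h
    simp [h, h.not_gt]

variable {n : ℕ} {p q : ℝ} {C : Finset (Fin n)}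

/-- Probability that the pair `i`, `j` is joined when the community is `C`. -/
noncomputable def edgeProb (p q : ℝ) (C : Finset (Fin n)) (i j : Fin n) : ℝ :=
  if i ∈ C ∧ j ∈ C then p else q

/-- Probability that the indicator of an edge takes a given value. -/
noncomputable def edgeWeight (p q : ℝ) (C : Finset (Fin n)) (e : Edge n) (b : Bool) : ℝ :=
  if b then edgeProb p q C e.1.1 e.1.2 else 1 - edgeProb p q C e.1.1 e.1.2

theorem edgeProb_comm (i j : Fin n) : edgeProb p q C i j = edgeProb p q C j i := by
  simp only [edgeProb, and_comm]

theorem edgeProb_nonneg (hp : 0 ≤ p) (hq : 0 ≤ q) (i j : Fin n) : 0 ≤ edgeProb p q C i j := by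
  unfold edgeProb; split_ifs <;> assumption

theorem edgeProb_le_one (hp : p ≤ 1) (hq : q ≤ 1) (i j : Fin n) : edgeProb p q C i j ≤ 1 := by
  unfold edgeProb; split_ifs <;> assumption

theorem edgeWeight_sum (e : Edge n) : ∑ b, edgeWeight p q C e b = 1 := by
  simp [edgeWeight]

theorem graphProb_eq_prod (G : SimpleGraph (Fin n)) :
    graphProb p q C G = ∏ e : Edge n, edgeWeight p q C e (graphEquiv n G e) := by
  classical
  rw [graphProb, Finset.prod_subtype (p := fun e : Fin n × Fin n => e.1 < e.2) _ (by simp)]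
  refine Fintype.prod_congr _ _ fun e => ?_
  simp [edgeWeight, graphEquiv, edgeProb]

theorem graphProb_nonneg (hp : 0 ≤ p) (hp1 : p ≤ 1) (hq : 0 ≤ q) (hq1 : q ≤ 1)
    (G : SimpleGraph (Fin n)) : 0 ≤ graphProb p q C G := by
  rw [graphProb_eq_prod]
  refine Finset.prod_nonneg fun e _ => ?_
  unfold edgeWeight
  split_ifs
  · exact edgeProb_nonneg hp hq _ _
  · linarith [edgeProb_le_one (C := C) hp1 hq1 e.1.1 e.1.2]

theorem sum_graphProb_mul_prod (x : Edge n → Bool → ℝ) :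
    ∑ G, graphProb p q C G * ∏ e, x e (graphEquiv n G e) =
      ∏ e, (edgeProb p q C e.1.1 e.1.2 * x e true +
        (1 - edgeProb p q C e.1.1 e.1.2) * x e false) := by
  simp only [graphProb_eq_prod, ← Finset.prod_mul_distrib]
  rw [Equiv.sum_comp (graphEquiv n) fun ω => ∏ e, edgeWeight p q C e (ω e) * x e (ω e),
    sum_pi_prod fun e b => edgeWeight p q C e b * x e b]
  refine Fintype.prod_congr _ _ fun e => ?_
  simp [edgeWeight]

theorem sum_graphProb : ∑ G, graphProb p q C G = 1 := by
  have := sum_graphProb_mul_prod (p := p) (q := q) (C := C) fun _ _ => 1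
  simpa using this

/-- Events that depend on disjoint sets of pairs are independent. -/
theorem wprob_graph_and (S : Set (Fin n × Fin n)) {A B : SimpleGraph (Fin n) → Prop}
    (hA : ∀ G H : SimpleGraph (Fin n),
      (∀ i j, (i, j) ∈ S ∨ (j, i) ∈ S → (G.Adj i j ↔ H.Adj i j)) → (A G ↔ A H))
    (hB : ∀ G H : SimpleGraph (Fin n),
      (∀ i j, (i, j) ∉ S → (j, i) ∉ S → (G.Adj i j ↔ H.Adj i j)) → (B G ↔ B H)) :
    wprob (graphProb p q C) (fun G => A G ∧ B G) =
      wprob (graphProb p q C) A * wprob (graphProb p q C) B := by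
  classical
  have key : ∀ P : SimpleGraph (Fin n) → Prop, wprob (graphProb p q C) P =
      wprob (fun x => ∏ e, edgeWeight p q C e (x e)) (fun x => P ((graphEquiv n).symm x)) := by
    intro P
    rw [wprob_equiv (graphEquiv n).symm]
    simp only [graphProb_eq_prod, Equiv.apply_symm_apply]
  rw [key, key A, key B]
  refine wprob_pi_and (fun e => edgeWeight p q C e) edgeWeight_sum
    {e : Edge n | (e.1.1, e.1.2) ∈ S ∨ (e.1.2, e.1.1) ∈ S} ?_ ?_
  · intro x y h
    refine hA _ _ fun i j hij => or_congr (exists_congr fun hlt => ?_) (exists_congr fun hlt => ?_)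
    · rw [h ⟨(i, j), hlt⟩ hij]
    · rw [h ⟨(j, i), hlt⟩ hij.symm]
  · intro x y h
    refine hB _ _ fun i j hij hji =>
      or_congr (exists_congr fun hlt => ?_) (exists_congr fun hlt => ?_)
    · rw [h ⟨(i, j), hlt⟩ fun h => h.elim hij hji]
    · rw [h ⟨(j, i), hlt⟩ fun h => h.elim hji hij]

/-- Degree sums and products over rectangles run over ordered pairs, while independence holds for
unordered ones. This is the passage between the two. -/
theorem prod_offDiag_eq_prod_edge {M : Type*} [CommMonoid M] (f : Fin n × Fin n → M)
    (hf : ∀ i, f (i, i) = 1) : ∏ e, f e = ∏ e : Edge n, f e.1 * f e.1.swap := by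
  have h1 : ∀ e : Fin n × Fin n, f e =
      (if e.1 < e.2 then f e else 1) * (if e.2 < e.1 then f e else 1) := by
    rintro ⟨i, j⟩
    rcases lt_trichotomy i j with h | h | h
    · simp [h, h.not_gt]
    · simp [h, hf]
    · simp [h, h.not_gt]
  rw [Fintype.prod_congr _ _ h1, Finset.prod_mul_distrib,
    ← Equiv.prod_comp (Equiv.prodComm _ _) fun e : Fin n × Fin n => if e.2 < e.1 then f e else 1,
    ← Finset.prod_mul_distrib]
  rw [← Finset.prod_subtype (p := fun e : Fin n × Fin n => e.1 < e.2)
    (Finset.univ.filter fun e : Fin n × Fin n => e.1 < e.2) (by simp) fun e => f e * f e.swap,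
    Finset.prod_filter]
  refine Fintype.prod_congr _ _ fun e => ?_
  by_cases h : e.1 < e.2 <;> simp [h]

theorem sum_offDiag_eq_sum_edge (f : Fin n × Fin n → ℝ)
    (hf : ∀ i, f (i, i) = 0) : ∑ e, f e = ∑ e : Edge n, (f e.1 + f e.1.swap) :=
  prod_offDiag_eq_prod_edge (M := Multiplicative ℝ) f hf

open Classical in
/-- Number of ordered pairs in `M` that are joined. -/
noncomputable def adjCount (G : SimpleGraph (Fin n)) (M : Finset (Fin n × Fin n)) : ℕ :=
  (M.filter fun e => G.Adj e.1 e.2).card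

open Classical in
/-- Number of neighbours of `i` in `D`. -/
noncomputable def degIn (G : SimpleGraph (Fin n)) (i : Fin n) (D : Finset (Fin n)) : ℕ :=
  (D.filter fun k => G.Adj i k).card

-- A rectangle may contain an unordered pair in both orders, so an edge has multiplicity 0, 1 or 2
-- in the exponent.
open Classical in
theorem pow_adjCount_eq_prod (G : SimpleGraph (Fin n)) (M : Finset (Fin n × Fin n)) (y : ℝ) :
    y ^ adjCount G M = ∏ e : Edge n, if graphEquiv n G e then
      y ^ ((if e.1 ∈ M then 1 else 0) + (if e.1.swap ∈ M then 1 else 0)) else 1 := by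
  have h1 : y ^ adjCount G M =
      ∏ e : Fin n × Fin n, if e ∈ M ∧ G.Adj e.1 e.2 then y else 1 := by
    rw [adjCount, ← Finset.prod_const, ← Finset.prod_filter]
    congr 1
    ext e
    simp
  rw [h1, prod_offDiag_eq_prod_edge _ (by simp)]
  refine Fintype.prod_congr _ _ fun e => ?_
  by_cases hG : G.Adj e.1.1 e.1.2 <;> by_cases h1 : e.1 ∈ M <;> by_cases h2 : e.1.swap ∈ M <;>
    simp [graphEquiv, hG, h1, h2, G.adj_comm e.1.2 e.1.1, sq]

/-- An edge of multiplicity `m ≤ 2` contributes `1 + r (y ^ m - 1)`, and `y ^ m - 1 ≤ m (y ^ 2 - 1)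
/ 2`; for `m = 1` this is `(y - 1) ^ 2 ≥ 0`. The multiplicities add up to the number of off-diagonal
pairs of `M`. Replacing that number by `M.card` is harmless if `y ≥ 1`; for `y < 1` it needs `M` to
avoid the diagonal, whence `hd`. -/
theorem sum_graphProb_mul_pow_le (hp : 0 ≤ p) (hp1 : p ≤ 1) (hq : 0 ≤ q) (hq1 : q ≤ 1)
    (M : Finset (Fin n × Fin n)) {r y : ℝ} (hr : 0 ≤ r) (hy : 0 ≤ y)
    (hM : ∀ e ∈ M, edgeProb p q C e.1 e.2 = r) (hd : 1 ≤ y ∨ ∀ e ∈ M, e.1 ≠ e.2) :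
    ∑ G, graphProb p q C G * y ^ adjCount G M ≤ Real.exp ((y ^ 2 - 1) / 2 * (r * M.card)) := by
  classical
  simp only [pow_adjCount_eq_prod]
  rw [sum_graphProb_mul_prod fun e b => if b then
      y ^ ((if e.1 ∈ M then 1 else 0) + (if e.1.swap ∈ M then 1 else 0)) else (1 : ℝ)]
  simp only [if_true, Bool.false_eq_true, if_false, mul_one]
  have hterm : ∀ e : Edge n, edgeProb p q C e.1.1 e.1.2 *
        y ^ ((if e.1 ∈ M then 1 else 0) + (if e.1.swap ∈ M then 1 else 0)) +
        (1 - edgeProb p q C e.1.1 e.1.2) ≤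
      Real.exp ((y ^ 2 - 1) / 2 * (r * ((if e.1 ∈ M then 1 else 0) +
        (if e.1.swap ∈ M then 1 else 0)))) := by
    intro e
    refine le_trans ?_ (Real.add_one_le_exp _)
    have h0 := edgeProb_nonneg (C := C) hp hq e.1.1 e.1.2
    by_cases h1 : e.1 ∈ M <;> by_cases h2 : e.1.swap ∈ M <;> simp only [h1, h2, if_true, if_false]
    · rw [hM _ h1] at *
      nlinarith
    · rw [hM _ h1] at *
      nlinarith [mul_nonneg hr (sq_nonneg (y - 1))]
    · have := hM _ h2
      rw [Prod.fst_swap, Prod.snd_swap, edgeProb_comm] at this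
      rw [this] at *
      nlinarith [mul_nonneg hr (sq_nonneg (y - 1))]
    · simp
  refine (Finset.prod_le_prod (fun e _ => ?_) fun e _ => hterm e).trans ?_
  · have h0 := edgeProb_nonneg (C := C) hp hq e.1.1 e.1.2
    have h1 := edgeProb_le_one (C := C) hp1 hq1 e.1.1 e.1.2
    have := pow_nonneg hy ((if e.1 ∈ M then 1 else 0) + (if e.1.swap ∈ M then 1 else 0))
    nlinarith [mul_nonneg h0 this]
  rw [← Real.exp_sum, ← Finset.mul_sum, ← Finset.mul_sum]
  refine Real.exp_le_exp.2 ?_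
  have hs := sum_offDiag_eq_sum_edge (fun e : Fin n × Fin n => if e ∈ M ∧ e.1 ≠ e.2 then 1 else 0)
    (by simp)
  have hs' : ∑ e : Edge n, ((if e.1 ∈ M then (1 : ℝ) else 0) + (if e.1.swap ∈ M then 1 else 0)) =
      ((M.filter fun e => e.1 ≠ e.2).card : ℝ) := by
    rw [Finset.card_filter, Nat.cast_sum]
    have : ∑ e ∈ M, ((if e.1 ≠ e.2 then 1 else 0 : ℕ) : ℝ) =
        ∑ e : Fin n × Fin n, if e ∈ M ∧ e.1 ≠ e.2 then 1 else 0 := by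
      rw [← Finset.sum_filter_add_sum_filter_not Finset.univ (· ∈ M)]
      rw [Finset.sum_filter_of_ne (p := (· ∈ M)) (by intro x _ h; by_contra h'; simp [h'] at h)]
      rw [Finset.sum_eq_zero (s := Finset.univ.filter (· ∉ M)) (by simp; tauto), add_zero]
      rw [← Finset.sum_filter_add_sum_filter_not Finset.univ (· ∈ M),
        Finset.sum_eq_zero (s := Finset.univ.filter (· ∉ M)) (by simp; tauto), add_zero]
      refine Finset.sum_congr (by simp) fun e he => ?_
      simp at he
      simp [he]
    rw [this, hs]
    refine Finset.sum_congr rfl fun e _ => ?_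
    have := e.2.ne
    simp [this, this.symm]
  rw [hs']
  rcases hd with hd | hd
  · have : ((M.filter fun e => e.1 ≠ e.2).card : ℝ) ≤ M.card :=
      Nat.cast_le.2 (Finset.card_filter_le _ _)
    have hy2 : 0 ≤ (y ^ 2 - 1) / 2 := by nlinarith
    gcongr
  · rw [Finset.filter_true_of_mem hd]

/-- Chernoff's inequality for the number of joined pairs. -/
theorem wprob_adjCount_le (hp : 0 ≤ p) (hp1 : p ≤ 1) (hq : 0 ≤ q) (hq1 : q ≤ 1)
    (M : Finset (Fin n × Fin n)) {r t x : ℝ} (hr : 0 ≤ r)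
    (hM : ∀ e ∈ M, edgeProb p q C e.1 e.2 = r) (hd : 0 ≤ t ∨ ∀ e ∈ M, e.1 ≠ e.2) :
    wprob (graphProb p q C) (fun G => t * x ≤ t * adjCount G M) ≤
      Real.exp ((Real.exp (2 * t) - 1) / 2 * (r * M.card) - t * x) := by
  -- With `y = exp t`, the sign of `t` selects the tail: upper for `t > 0`, lower for `t < 0`.
  have h := sum_graphProb_mul_pow_le hp hp1 hq hq1 M hr (Real.exp_pos t).le hM
    (hd.imp_left Real.one_le_exp)
  rw [← Real.exp_nat_mul, Nat.cast_ofNat] at h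
  rw [Real.exp_sub, div_eq_mul_inv, ← Real.exp_neg]
  refine le_trans ?_ (mul_le_mul_of_nonneg_right h (Real.exp_pos _).le)
  rw [Finset.sum_mul]
  simp only [mul_assoc]
  refine wprob_le_sum (graphProb_nonneg hp hp1 hq hq1) (fun G => by positivity) fun G hG => ?_
  rw [← Real.exp_nat_mul, ← Real.exp_add]
  exact Real.one_le_exp (by linarith)

theorem adjCount_product (G : SimpleGraph (Fin n)) (S D : Finset (Fin n)) :
    adjCount G (S ×ˢ D) = ∑ i ∈ S, degIn G i D := by
  classical
  simp only [adjCount, degIn, Finset.card_filter, Finset.sum_product]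

/-- Chernoff's inequality for the number of neighbours of a node. -/
theorem wprob_degIn_le (hp : 0 ≤ p) (hp1 : p ≤ 1) (hq : 0 ≤ q) (hq1 : q ≤ 1)
    {i : Fin n} {D : Finset (Fin n)} (hi : i ∉ D) {r t x : ℝ} (hr : 0 ≤ r)
    (hD : ∀ k ∈ D, edgeProb p q C i k = r) :
    wprob (graphProb p q C) (fun G => t * x ≤ t * degIn G i D) ≤
      Real.exp ((Real.exp t - 1) * (r * D.card) - t * x) := by
  classical
  -- Each pair is taken in both orders, so every multiplicity is 2, where the moment bound loses
  -- nothing to convexity. With `t / 2` and `2 x` it then yields the sharp exponent in `exp t - 1`.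
  have hdisj : Disjoint (({i} : Finset (Fin n)) ×ˢ D) (D ×ˢ {i}) := by
    rw [Finset.disjoint_left]
    rintro ⟨u, v⟩ h1 h2
    simp only [Finset.mem_product, Finset.mem_singleton] at h1 h2
    exact hi (h1.1 ▸ h2.1)
  have hcard : (({i} ×ˢ D ∪ D ×ˢ {i} : Finset (Fin n × Fin n))).card = 2 * D.card := by
    rw [Finset.card_union_of_disjoint hdisj]
    simp
    ring
  have hcount : ∀ G : SimpleGraph (Fin n),
      adjCount G ({i} ×ˢ D ∪ D ×ˢ {i}) = 2 * degIn G i D := by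
    intro G
    rw [adjCount, Finset.filter_union,
      Finset.card_union_of_disjoint (Finset.disjoint_filter_filter hdisj)]
    change adjCount G _ + adjCount G _ = _
    rw [adjCount_product, adjCount_product, Finset.sum_singleton]
    have : ∑ k ∈ D, degIn G k {i} = degIn G i D := by
      simp only [degIn, Finset.card_filter, Finset.sum_singleton, G.adj_comm i]
    rw [this]
    ring
  have hM : ∀ e ∈ ({i} ×ˢ D ∪ D ×ˢ {i} : Finset (Fin n × Fin n)),
      edgeProb p q C e.1 e.2 = r := by
    rintro ⟨u, v⟩ h
    simp only [Finset.mem_union, Finset.mem_product, Finset.mem_singleton] at h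
    rcases h with ⟨rfl, h⟩ | ⟨h, rfl⟩
    · exact hD v h
    · exact (edgeProb_comm _ _).trans (hD u h)
  have hd : ∀ e ∈ ({i} ×ˢ D ∪ D ×ˢ {i} : Finset (Fin n × Fin n)), e.1 ≠ e.2 := by
    rintro ⟨u, v⟩ h
    simp only [Finset.mem_union, Finset.mem_product, Finset.mem_singleton] at h
    rcases h with ⟨rfl, h⟩ | ⟨h, rfl⟩
    · exact fun e : u = v => hi (e ▸ h)
    · exact fun e : u = v => hi (e ▸ h)
  have h := wprob_adjCount_le (t := t / 2) (x := 2 * x) hp hp1 hq hq1 _ hr hM (Or.inr hd)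
  simp only [hcount, hcard] at h
  convert h using 2
  · funext G
    push_cast
    rw [show t / 2 * (2 * x) = t * x by ring, show t / 2 * (2 * (degIn G i D : ℝ)) =
      t * degIn G i D by ring]
  · rw [show 2 * (t / 2) = t by ring]
    push_cast
    ring

theorem wprob_not_adj {i k : Fin n} (hik : i ≠ k) :
    wprob (graphProb p q C) (fun G => ¬ G.Adj i k) = 1 - edgeProb p q C i k := by
  classical
  wlog h : i < k generalizing i k
  · have := this hik.symm (lt_of_le_of_ne (not_lt.1 h) hik.symm)
    rw [edgeProb_comm, ← this]
    exact wprob_congr fun G => by rw [G.adj_comm]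
  have h1 := sum_graphProb_mul_prod (p := p) (q := q) (C := C)
    fun e b => if e = ⟨(i, k), h⟩ ∧ b = true then 0 else 1
  rw [Finset.prod_eq_single ⟨(i, k), h⟩ (by intro e _ he; simp [he]) (by simp)] at h1
  simp only [true_and, if_true, mul_zero, Bool.false_eq_true, and_false, if_false, mul_one,
    zero_add] at h1
  rw [← h1, wprob]
  refine Finset.sum_congr rfl fun G _ => ?_
  rw [Finset.prod_eq_single ⟨(i, k), h⟩ (by intro e _ he; simp [he]) (by simp)]
  by_cases hG : G.Adj i k <;> simp [graphEquiv, hG]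

theorem wprob_adj {i k : Fin n} (hik : i ≠ k) :
    wprob (graphProb p q C) (fun G => G.Adj i k) = edgeProb p q C i k := by
  have h := wprob_not (w := graphProb p q C) (A := fun G => G.Adj i k)
  rw [wprob_not_adj hik, sum_graphProb] at h
  linarith

theorem degIn_congr {G H : SimpleGraph (Fin n)} {i : Fin n} {D : Finset (Fin n)}
    (h : ∀ k ∈ D, (G.Adj i k ↔ H.Adj i k)) : degIn G i D = degIn H i D := by
  classical
  rw [degIn, degIn, Finset.filter_congr h]

open Classical in
theorem degIn_insert (G : SimpleGraph (Fin n)) {i k : Fin n} {D : Finset (Fin n)} (hk : k ∉ D) :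
    degIn G i (insert k D) = (if G.Adj i k then 1 else 0) + degIn G i D := by
  simp only [degIn, Finset.card_filter, Finset.sum_insert hk]

theorem wprob_degIn_and {i k : Fin n} {D : Finset (Fin n)} (hi : i ∉ D) (hk : k ∉ D)
    (P : Prop → Prop) (Q : ℕ → Prop) :
    wprob (graphProb p q C) (fun G => P (G.Adj i k) ∧ Q (degIn G i D)) =
      wprob (graphProb p q C) (fun G => P (G.Adj i k)) *
        wprob (graphProb p q C) (fun G => Q (degIn G i D)) := by
  refine wprob_graph_and {(i, k)} (fun G H h => ?_) (fun G H h => ?_)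
  · rw [propext (h i k (Or.inl rfl))]
  · rw [degIn_congr fun l hl => h i l ?_ ?_]
    · simp only [Set.mem_singleton_iff, Prod.mk.injEq, true_and]
      exact fun e => hk (e ▸ hl)
    · simp only [Set.mem_singleton_iff, Prod.mk.injEq]
      exact fun e => hi (e.1 ▸ hl)

/-- The number of neighbours in a set with constant edge probability is binomial. -/
theorem wprob_degIn_eq {i : Fin n} {r : ℝ} (D : Finset (Fin n)) (hi : i ∉ D)
    (hD : ∀ k ∈ D, edgeProb p q C i k = r) (m : ℕ) :
    wprob (graphProb p q C) (fun G => degIn G i D = m) =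
      D.card.choose m * r ^ m * (1 - r) ^ (D.card - m) := by
  classical
  induction D using Finset.induction_on generalizing m with
  | empty =>
    cases m with
    | zero =>
      have := sum_graphProb (p := p) (q := q) (C := C)
      simpa [wprob, degIn] using this
    | succ m => simp [wprob, degIn]
  | insert k D hk ih =>
    have hiD : i ∉ D := fun h => hi (Finset.mem_insert_of_mem h)
    have hik : i ≠ k := fun h => hi (h ▸ Finset.mem_insert_self _ _)
    have hr : edgeProb p q C i k = r := hD k (Finset.mem_insert_self _ _)
    have ih := ih hiD fun l hl => hD l (Finset.mem_insert_of_mem hl)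
    have hno := wprob_degIn_and (p := p) (q := q) (C := C) hiD hk (fun P => ¬ P)
    have hyes := wprob_degIn_and (p := p) (q := q) (C := C) hiD hk (fun P => P)
    rw [wprob_not_adj hik, hr] at hno
    rw [wprob_adj hik, hr] at hyes
    rw [Finset.card_insert_of_notMem hk]
    have split : ∀ P : SimpleGraph (Fin n) → Prop, wprob (graphProb p q C) P =
        wprob (graphProb p q C) (fun G => G.Adj i k ∧ P G) +
        wprob (graphProb p q C) (fun G => ¬ G.Adj i k ∧ P G) := by
      intro P
      rw [wprob, wprob, wprob, ← Finset.sum_add_distrib]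
      refine Finset.sum_congr rfl fun G _ => ?_
      by_cases h : G.Adj i k <;> simp [h]
    rw [split]
    cases m with
    | zero =>
      have e1 : wprob (graphProb p q C) (fun G => G.Adj i k ∧ degIn G i (insert k D) = 0) = 0 := by
        rw [wprob_congr (B := fun _ => False)]
        · simp [wprob]
        · intro G
          rw [degIn_insert G hk]
          by_cases h : G.Adj i k <;> simp [h]
      have e2 : wprob (graphProb p q C) (fun G => ¬ G.Adj i k ∧ degIn G i (insert k D) = 0) =
          wprob (graphProb p q C) (fun G => ¬ G.Adj i k ∧ degIn G i D = 0) := by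
        refine wprob_congr fun G => ?_
        rw [degIn_insert G hk]
        by_cases h : G.Adj i k <;> simp [h]
      rw [e1, e2, hno fun l => l = 0, ih]
      simp
      ring
    | succ m =>
      have e1 : wprob (graphProb p q C) (fun G => G.Adj i k ∧ degIn G i (insert k D) = m + 1) =
          wprob (graphProb p q C) (fun G => G.Adj i k ∧ degIn G i D = m) := by
        refine wprob_congr fun G => ?_
        rw [degIn_insert G hk]
        by_cases h : G.Adj i k <;> simp [h, add_comm]
      have e2 : wprob (graphProb p q C) (fun G => ¬ G.Adj i k ∧ degIn G i (insert k D) = m + 1) =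
          wprob (graphProb p q C) (fun G => ¬ G.Adj i k ∧ degIn G i D = m + 1) := by
        refine wprob_congr fun G => ?_
        rw [degIn_insert G hk]
        by_cases h : G.Adj i k <;> simp [h]
      rw [e1, e2, hno fun l => l = m + 1, hyes fun l => l = m, ih, ih, Nat.choose_succ_succ]
      push_cast
      rw [Nat.succ_eq_add_one]
      -- Truncated subtraction breaks `D.card - m = D.card - (m + 1) + 1` when `D.card < m + 1`, but
      -- there `D.card.choose (m + 1)` vanishes.
      rcases lt_or_ge D.card (m + 1) with h | h
      · rw [Nat.choose_eq_zero_of_lt h]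
        push_cast
        ring
      · rw [show D.card - m = D.card - (m + 1) + 1 by omega]
        ring

end RandomGraph

/-! ### Side information, joint law, and the estimator built from node tests. -/

section Model

variable {M : ℕ} {L : Fin M → ℕ} {F : Features L} {n : ℕ} {p q : ℝ} {C : Finset (Fin n)}

/-- Probability of an outcome at a node of the community. -/
noncomputable def insideLik (F : Features L) (n : ℕ) (o : Outcome L) : ℝ :=
  ∏ m, F.inside n m (o m)

/-- Probability of an outcome at a node outside the community. -/
noncomputable def outsideLik (F : Features L) (n : ℕ) (o : Outcome L) : ℝ :=
  ∏ m, F.outside n m (o m)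

/-- Probability of an outcome at the node `i`. -/
noncomputable def nodeLik (F : Features L) (C : Finset (Fin n)) (i : Fin n) (o : Outcome L) : ℝ :=
  if i ∈ C then insideLik F n o else outsideLik F n o

theorem insideLik_nonneg (o : Outcome L) : 0 ≤ insideLik F n o :=
  Finset.prod_nonneg fun m _ => F.inside_nonneg n m _

theorem outsideLik_nonneg (o : Outcome L) : 0 ≤ outsideLik F n o :=
  Finset.prod_nonneg fun m _ => F.outside_nonneg n m _

theorem nodeLik_nonneg (i : Fin n) (o : Outcome L) : 0 ≤ nodeLik F C i o := by
  unfold nodeLik; split_ifs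
  exacts [insideLik_nonneg o, outsideLik_nonneg o]

theorem nodeLik_sum (i : Fin n) : ∑ o, nodeLik F C i o = 1 := by
  unfold nodeLik insideLik outsideLik
  split_ifs
  · rw [sum_pi_prod (fun m => F.inside n m)]
    simp [F.inside_sum]
  · rw [sum_pi_prod (fun m => F.outside n m)]
    simp [F.outside_sum]

theorem sideProb_eq_prod (Y : Fin n → Outcome L) :
    sideProb F C Y = ∏ i, nodeLik F C i (Y i) := by
  refine Finset.prod_congr rfl fun i _ => ?_
  unfold nodeLik insideLik outsideLik
  split_ifs <;> rfl

theorem sideProb_nonneg (Y : Fin n → Outcome L) : 0 ≤ sideProb F C Y := by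
  rw [sideProb_eq_prod]
  exact Finset.prod_nonneg fun i _ => nodeLik_nonneg i _

theorem sum_sideProb : ∑ Y, sideProb F C Y = 1 := by
  simp only [sideProb_eq_prod]
  rw [sum_pi_prod (fun i => nodeLik F C i)]
  simp [nodeLik_sum]

theorem wprob_sideProb_eq (i : Fin n) (o : Outcome L) :
    wprob (sideProb F C) (fun Y => Y i = o) = nodeLik F C i o := by
  classical
  have h := sum_pi_prod (fun (j : Fin n) (x : Outcome L) =>
    nodeLik F C j x * if j = i ∧ x ≠ o then 0 else 1)
  rw [Finset.prod_eq_single i (fun j _ hj => by simp [hj, nodeLik_sum]) (by simp)] at h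
  simp only [Finset.prod_mul_distrib] at h
  have h2 : ∑ x, nodeLik F C i x * (if True ∧ x ≠ o then 0 else 1) = nodeLik F C i o := by
    rw [Finset.sum_eq_single o (fun x _ hx => by simp [hx]) (by simp)]
    simp
  rw [h2] at h
  rw [← h, wprob]
  refine Finset.sum_congr rfl fun Y _ => ?_
  rw [sideProb_eq_prod, Finset.prod_eq_single (f := fun j => if j = i ∧ Y j ≠ o then (0 : ℝ) else 1)
    i (fun j _ hj => by simp [hj]) (by simp)]
  by_cases hY : Y i = o <;> simp [hY]

theorem wprob_sideProb_eq_and {i j : Fin n} (hij : i ≠ j) (o o' : Outcome L) :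
    wprob (sideProb F C) (fun Y => Y i = o ∧ Y j = o') =
      nodeLik F C i o * nodeLik F C j o' := by
  rw [← wprob_sideProb_eq, ← wprob_sideProb_eq]
  have hs : sideProb F C = fun Y => ∏ i, nodeLik F C i (Y i) := funext sideProb_eq_prod
  rw [hs]
  refine wprob_pi_and (fun i => nodeLik F C i) nodeLik_sum {i} (fun x y h => ?_) fun x y h => ?_
  · rw [h i rfl]
  · rw [h j hij.symm]

/-- Joint probability of a graph and a side-information matrix when the community is `C`. -/
noncomputable def modelProb (F : Features L) (p q : ℝ) (C : Finset (Fin n))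
    (ω : SimpleGraph (Fin n) × (Fin n → Outcome L)) : ℝ :=
  graphProb p q C ω.1 * sideProb F C ω.2

theorem modelProb_nonneg (hp : 0 ≤ p) (hp1 : p ≤ 1) (hq : 0 ≤ q) (hq1 : q ≤ 1)
    (ω : SimpleGraph (Fin n) × (Fin n → Outcome L)) : 0 ≤ modelProb F p q C ω :=
  mul_nonneg (graphProb_nonneg hp hp1 hq hq1 _) (sideProb_nonneg _)

theorem wprob_modelProb_and (A : SimpleGraph (Fin n) → Prop)
    (B : (Fin n → Outcome L) → Prop) :
    wprob (modelProb F p q C) (fun ω => A ω.1 ∧ B ω.2) =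
      wprob (graphProb p q C) A * wprob (sideProb F C) B :=
  wprob_prod _ _ A B

theorem wprob_modelProb_graph (A : SimpleGraph (Fin n) → Prop) :
    wprob (modelProb F p q C) (fun ω => A ω.1) = wprob (graphProb p q C) A := by
  have := wprob_modelProb_and (F := F) (p := p) (q := q) (C := C) A fun _ => True
  rw [wprob_true, sum_sideProb, mul_one] at this
  simpa using this

theorem sum_modelProb : ∑ ω, modelProb F p q C ω = 1 := by
  have := wprob_modelProb_graph (F := F) (p := p) (q := q) (C := C) fun _ => True
  rwa [wprob_true, wprob_true, sum_graphProb] at this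

theorem successProb_eq (K : ℕ) (est : Estimator L n) :
    successProb F n K p q est =
      (∑ C ∈ Finset.powersetCard K (Finset.univ : Finset (Fin n)),
        wprob (modelProb F p q C) fun ω => est ω.1 ω.2 = C) / (n.choose K : ℝ) := by
  simp only [successProb, wprob, Fintype.sum_prod_type, modelProb]

/-- The community `C` agrees with the data: every node of `C` passes the test `Pin` for its outcome
and its number of neighbours in `C`, and every other node passes the test `Pout`. -/
def Consistent (Pin Pout : Outcome L → ℕ → Prop) (G : SimpleGraph (Fin n))
    (Y : Fin n → Outcome L) (C : Finset (Fin n)) : Prop :=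
  (∀ i ∈ C, Pin (Y i) (degIn G i C)) ∧ ∀ i ∉ C, Pout (Y i) (degIn G i C)

open Classical in
/-- The estimator that returns some `K`-element set that agrees with the data. -/
noncomputable def consistentEstimator (Pin Pout : Outcome L → ℕ → Prop) (n K : ℕ) :
    Estimator L n := fun G Y =>
  if h : ∃ C : Finset (Fin n), C.card = K ∧ Consistent Pin Pout G Y C then h.choose else ∅

theorem consistentEstimator_eq {Pin Pout : Outcome L → ℕ → Prop} {K : ℕ}
    {G : SimpleGraph (Fin n)} {Y : Fin n → Outcome L} (hC : C.card = K)
    (h : Consistent Pin Pout G Y C)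
    (hu : ∀ D : Finset (Fin n), D.card = K → D ≠ C → ¬ Consistent Pin Pout G Y D) :
    consistentEstimator Pin Pout n K G Y = C := by
  have hex : ∃ C : Finset (Fin n), C.card = K ∧ Consistent Pin Pout G Y C := ⟨C, hC, h⟩
  rw [consistentEstimator, dif_pos hex]
  by_contra hne
  exact hu _ hex.choose_spec.1 hne hex.choose_spec.2

theorem degIn_le_add {G : SimpleGraph (Fin n)} {i : Fin n} {D D₁ D₂ : Finset (Fin n)}
    (h : D ⊆ D₁ ∪ D₂) : degIn G i D ≤ degIn G i D₁ + degIn G i D₂ := by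
  classical
  simp only [degIn]
  refine le_trans (Finset.card_le_card (Finset.filter_subset_filter _ h)) ?_
  rw [Finset.filter_union]
  exact Finset.card_union_le _ _

/-- A union bound over nodes and outcomes; given the community, outcome and degree are independent,
so each term factors. -/
theorem wprob_not_consistent_le (hp : 0 ≤ p) (hp1 : p ≤ 1) (hq : 0 ≤ q) (hq1 : q ≤ 1)
    (Pin Pout : Outcome L → ℕ → Prop) :
    wprob (modelProb F p q C) (fun ω => ¬ Consistent Pin Pout ω.1 ω.2 C) ≤
      (∑ i ∈ C, ∑ o, insideLik F n o *
        wprob (graphProb p q C) fun G => ¬ Pin o (degIn G i C)) +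
      ∑ i ∈ Cᶜ, ∑ o, outsideLik F n o *
        wprob (graphProb p q C) fun G => ¬ Pout o (degIn G i C) := by
  classical
  have hw := modelProb_nonneg (F := F) (C := C) hp hp1 hq hq1
  have hterm : ∀ (P : Outcome L → ℕ → Prop) (i : Fin n),
      wprob (modelProb F p q C) (fun ω => ¬ P (ω.2 i) (degIn ω.1 i C)) ≤
      ∑ o, nodeLik F C i o * wprob (graphProb p q C) fun G => ¬ P o (degIn G i C) := by
    intro P i
    calc _ ≤ wprob (modelProb F p q C) (fun ω => ∃ o ∈ (Finset.univ : Finset (Outcome L)),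
          ¬ P o (degIn ω.1 i C) ∧ ω.2 i = o) :=
          wprob_mono hw fun ω h => ⟨ω.2 i, Finset.mem_univ _, h, rfl⟩
      _ ≤ _ := wprob_exists_le hw _ _
      _ = _ := by
          refine Finset.sum_congr rfl fun o _ => ?_
          rw [wprob_modelProb_and (fun G => ¬ P o (degIn G i C)) (fun Y => Y i = o),
            wprob_sideProb_eq, mul_comm]
  calc _ ≤ wprob (modelProb F p q C) (fun ω => (∃ i ∈ C, ¬ Pin (ω.2 i) (degIn ω.1 i C)) ∨
        ∃ i ∈ Cᶜ, ¬ Pout (ω.2 i) (degIn ω.1 i C)) := by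
        refine wprob_mono hw fun ω h => ?_
        simp only [Consistent, not_and_or, not_forall] at h
        simpa using h
    _ ≤ _ := (wprob_or_le hw).trans (add_le_add (wprob_exists_le hw _ _) (wprob_exists_le hw _ _))
    _ ≤ _ := by
        refine add_le_add (Finset.sum_le_sum fun i hi => ?_) (Finset.sum_le_sum fun i hi => ?_)
        · simpa [nodeLik, hi] using hterm Pin i
        · simpa [nodeLik, Finset.mem_compl.1 hi] using hterm Pout i

/-- Two sets that both agree with the data differ in a set `S` of nodes that spans many edges and
is joined by many edges to the second set. -/
theorem Consistent.le_adjCount {Pin Pout : Outcome L → ℕ → Prop} {g h : ℝ}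
    (hsep : ∀ o (e e' : ℕ), Pin o e → Pout o e' → (e' : ℝ) + g ≤ e ∧ h ≤ e)
    {G : SimpleGraph (Fin n)} {Y : Fin n → Outcome L} {D : Finset (Fin n)}
    (hC : Consistent Pin Pout G Y C) (hD : Consistent Pin Pout G Y D) :
    g * (D \ C).card ≤ adjCount G ((D \ C) ×ˢ (D \ C)) ∧
      h * (D \ C).card ≤ adjCount G ((D \ C) ×ˢ D) := by
  -- Such a node passes `Pin` relative to `D` and `Pout` relative to `C` with one and the same
  -- outcome. The gap between its two degrees must be made up by neighbours in `D \ C`.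
  have key : ∀ i ∈ D \ C, g ≤ degIn G i (D \ C) ∧ h ≤ degIn G i D := by
    intro i hi
    rw [Finset.mem_sdiff] at hi
    obtain ⟨h1, h2⟩ := hsep _ _ _ (hD.1 i hi.1) (hC.2 i hi.2)
    refine ⟨?_, h2⟩
    have : degIn G i D ≤ degIn G i C + degIn G i (D \ C) :=
      degIn_le_add (by rw [Finset.union_sdiff_self_eq_union]; exact Finset.subset_union_right)
    have : (degIn G i D : ℝ) ≤ degIn G i C + degIn G i (D \ C) := by exact_mod_cast this
    linarith
  rw [adjCount_product, adjCount_product]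
  push_cast
  constructor
  · rw [mul_comm, ← nsmul_eq_mul]
    exact Finset.card_nsmul_le_sum _ _ _ fun i hi => (key i hi).1
  · rw [mul_comm, ← nsmul_eq_mul]
    exact Finset.card_nsmul_le_sum _ _ _ fun i hi => (key i hi).2

/-- A union bound split by `k = (D \ C).card`. For `k ≤ k₀` only `D \ C` is enumerated, at a cost of
`n.choose k`, and the density inside it is used. For larger `k` the whole of `D` is enumerated, and
the pairs between `D \ C` and `D` are used. Each such pair has an end outside `C`, hence edge
probability `q`. -/
theorem wprob_exists_consistent_le (hp : 0 ≤ p) (hp1 : p ≤ 1) (hq : 0 ≤ q) (hq1 : q ≤ 1)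
    {Pin Pout : Outcome L → ℕ → Prop} {g h : ℝ}
    (hsep : ∀ o (e e' : ℕ), Pin o e → Pout o e' → (e' : ℝ) + g ≤ e ∧ h ≤ e)
    {K : ℕ} (hC : C.card = K) (k₀ : ℕ) {t₁ t₂ X : ℝ} (ht₁ : 0 ≤ t₁) (ht₂ : 0 ≤ t₂)
    (hX : ∀ k : ℕ, k₀ < k →
      (Real.exp (2 * t₂) - 1) / 2 * (q * (k * K)) - t₂ * (h * k) ≤ X) :
    wprob (modelProb F p q C) (fun ω => Consistent Pin Pout ω.1 ω.2 C ∧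
        ∃ D : Finset (Fin n), D.card = K ∧ D ≠ C ∧ Consistent Pin Pout ω.1 ω.2 D) ≤
      (∑ k ∈ Finset.Icc 1 k₀, (n.choose k : ℝ) *
        Real.exp ((Real.exp (2 * t₁) - 1) / 2 * (q * (k * k)) - t₁ * (g * k))) +
      n.choose K * Real.exp X := by
  classical
  have hw := graphProb_nonneg (C := C) hp hp1 hq hq1
  let U (k : ℕ) : Finset (Finset (Fin n)) :=
    (Finset.powersetCard k Finset.univ).filter fun S => Disjoint S C
  let V : Finset (Finset (Fin n)) :=
    (Finset.powersetCard K Finset.univ).filter fun D => k₀ < (D \ C).card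
  have hM : ∀ S : Finset (Fin n), Disjoint S C → ∀ D : Finset (Fin n), ∀ e ∈ S ×ˢ D,
      edgeProb p q C e.1 e.2 = q := by
    intro S hS D e he
    have := Finset.disjoint_left.1 hS (Finset.mem_product.1 he).1
    simp [edgeProb, this]
  have h1 : wprob (graphProb p q C) (fun G => ∃ k ∈ Finset.Icc 1 k₀, ∃ S ∈ U k,
      t₁ * (g * k) ≤ t₁ * adjCount G (S ×ˢ S)) ≤
      ∑ k ∈ Finset.Icc 1 k₀, (n.choose k : ℝ) *
        Real.exp ((Real.exp (2 * t₁) - 1) / 2 * (q * (k * k)) - t₁ * (g * k)) := by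
    refine (wprob_exists_le hw _ _).trans (Finset.sum_le_sum fun k _ => ?_)
    refine (wprob_exists_le hw _ _).trans ?_
    refine (Finset.sum_le_card_nsmul (U k) _
      (Real.exp ((Real.exp (2 * t₁) - 1) / 2 * (q * (k * k)) - t₁ * (g * k)))
      fun S hS => ?_).trans ?_
    · simp only [U, Finset.mem_filter, Finset.mem_powersetCard] at hS
      have := wprob_adjCount_le hp hp1 hq hq1 (S ×ˢ S) (t := t₁) (x := g * k) hq (hM S hS.2 S)
        (Or.inl ht₁)
      rw [Finset.card_product, hS.1.2] at this
      exact_mod_cast this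
    · rw [nsmul_eq_mul]
      gcongr
      refine (Finset.card_filter_le _ _).trans ?_
      simp
  have h2 : wprob (graphProb p q C) (fun G => ∃ D ∈ V,
      t₂ * (h * (D \ C).card) ≤ t₂ * adjCount G ((D \ C) ×ˢ D)) ≤ n.choose K * Real.exp X := by
    refine (wprob_exists_le hw _ _).trans ?_
    refine (Finset.sum_le_card_nsmul V _ (Real.exp X) fun D hD => ?_).trans ?_
    · simp only [V, Finset.mem_filter, Finset.mem_powersetCard] at hD
      have := wprob_adjCount_le hp hp1 hq hq1 ((D \ C) ×ˢ D) (t := t₂)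
        (x := h * (D \ C).card) hq (hM _ Finset.sdiff_disjoint D) (Or.inl ht₂)
      refine this.trans (Real.exp_le_exp.2 ?_)
      rw [Finset.card_product, hD.1.2]
      exact_mod_cast hX _ hD.2
    · rw [nsmul_eq_mul]
      gcongr
      refine (Finset.card_filter_le _ _).trans ?_
      simp
  refine le_trans ?_ (add_le_add h1 h2)
  refine le_trans ?_ (wprob_or_le hw)
  rw [← wprob_modelProb_graph (F := F)]
  refine wprob_mono (modelProb_nonneg hp hp1 hq hq1) ?_
  rintro ⟨G, Y⟩ ⟨hcC, D, hDK, hDC, hcD⟩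
  obtain ⟨hg, hh⟩ := hcC.le_adjCount hsep hcD
  -- Distinct sets of equal size are not nested.
  have hpos : 1 ≤ (D \ C).card := by
    rw [Nat.one_le_iff_ne_zero, Ne, Finset.card_eq_zero, Finset.sdiff_eq_empty_iff_subset]
    exact fun hsub => hDC (Finset.eq_of_subset_of_card_le hsub (by omega))
  rcases le_or_gt (D \ C).card k₀ with hk | hk
  · exact Or.inl ⟨(D \ C).card, Finset.mem_Icc.2 ⟨hpos, hk⟩, D \ C,
      Finset.mem_filter.2 ⟨Finset.mem_powersetCard.2 ⟨Finset.subset_univ _, rfl⟩,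
        Finset.sdiff_disjoint⟩, mul_le_mul_of_nonneg_left hg ht₁⟩
  · exact Or.inr ⟨D, Finset.mem_filter.2 ⟨Finset.mem_powersetCard.2
      ⟨Finset.subset_univ _, hDK⟩, hk⟩, mul_le_mul_of_nonneg_left hh ht₂⟩

theorem le_wprob_consistentEstimator (hp : 0 ≤ p) (hp1 : p ≤ 1) (hq : 0 ≤ q) (hq1 : q ≤ 1)
    (Pin Pout : Outcome L → ℕ → Prop) {K : ℕ} (hC : C.card = K) :
    1 - wprob (modelProb F p q C) (fun ω => ¬ Consistent Pin Pout ω.1 ω.2 C) -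
      wprob (modelProb F p q C) (fun ω => Consistent Pin Pout ω.1 ω.2 C ∧
        ∃ D : Finset (Fin n), D.card = K ∧ D ≠ C ∧ Consistent Pin Pout ω.1 ω.2 D) ≤
      wprob (modelProb F p q C) fun ω => consistentEstimator Pin Pout n K ω.1 ω.2 = C := by
  have hw := modelProb_nonneg (F := F) (C := C) hp hp1 hq hq1
  have h := wprob_not (w := modelProb F p q C)
    (A := fun ω => consistentEstimator Pin Pout n K ω.1 ω.2 = C)
  rw [sum_modelProb] at h
  have h2 : wprob (modelProb F p q C)
      (fun ω => ¬ consistentEstimator Pin Pout n K ω.1 ω.2 = C) ≤ _ :=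
    (wprob_mono hw fun ω hω => ?_).trans (wprob_or_le
      (A := fun ω => ¬ Consistent Pin Pout ω.1 ω.2 C)
      (B := fun ω => Consistent Pin Pout ω.1 ω.2 C ∧
        ∃ D : Finset (Fin n), D.card = K ∧ D ≠ C ∧ Consistent Pin Pout ω.1 ω.2 D) hw)
  · linarith
  · by_cases hc : Consistent Pin Pout ω.1 ω.2 C
    · refine Or.inr ⟨hc, ?_⟩
      by_contra hD
      push Not at hD
      exact hω (consistentEstimator_eq hC hc hD)
    · exact Or.inl hc

theorem successProb_le_one (hp : 0 ≤ p) (hp1 : p ≤ 1) (hq : 0 ≤ q) (hq1 : q ≤ 1)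
    (K : ℕ) (est : Estimator L n) : successProb F n K p q est ≤ 1 := by
  rw [successProb_eq]
  refine div_le_one_of_le₀ ?_ (Nat.cast_nonneg _)
  refine (Finset.sum_le_card_nsmul _ _ 1 fun C _ =>
    wprob_le_one (modelProb_nonneg hp hp1 hq hq1) sum_modelProb).trans ?_
  simp

theorem le_successProb {K : ℕ} (hK : K ≤ n) {est : Estimator L n} {x : ℝ}
    (h : ∀ C : Finset (Fin n), C.card = K →
      x ≤ wprob (modelProb F p q C) fun ω => est ω.1 ω.2 = C) :
    x ≤ successProb F n K p q est := by
  have hpos : (0 : ℝ) < n.choose K := by exact_mod_cast Nat.choose_pos hK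
  rw [successProb_eq, le_div_iff₀ hpos]
  have := Finset.card_nsmul_le_sum (Finset.powersetCard K (Finset.univ : Finset (Fin n)))
    (fun C => wprob (modelProb F p q C) fun ω => est ω.1 ω.2 = C) x
    fun C hC => h C (Finset.mem_powersetCard.1 hC).2
  simp only [Finset.card_powersetCard, Finset.card_univ, Fintype.card_fin, nsmul_eq_mul] at this
  linarith

end Model

/-! ### Exchanging two nodes, and the resulting bound on every estimator. -/

section Swap

variable {M : ℕ} {L : Fin M → ℕ} {F : Features L} {n : ℕ} {p q : ℝ} {C : Finset (Fin n)}

open Classical in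
/-- Likelihood ratio of the hypotheses that a pair has edge probability `p` and `q`. -/
noncomputable def pairRatio (p q : ℝ) (G : SimpleGraph (Fin n)) (i j : Fin n) : ℝ :=
  if i = j then 1 else if G.Adj i j then p / q else (1 - p) / (1 - q)

theorem pairRatio_comm (G : SimpleGraph (Fin n)) (i j : Fin n) :
    pairRatio p q G i j = pairRatio p q G j i := by
  rcases eq_or_ne i j with rfl | h
  · rfl
  · by_cases hG : G.Adj i j <;> simp [pairRatio, h, h.symm, G.adj_comm j i, hG]

/-- The product over `C × C` meets each pair twice, hence the squares. In this ordered form,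
adjoining a node to `C` expands without regard to the order of the nodes. -/
theorem graphProb_sq (hq : 0 < q) (hq1 : q < 1) (G : SimpleGraph (Fin n)) :
    graphProb p q C G ^ 2 =
      (graphProb q q ∅ G) ^ 2 * ∏ i ∈ C, ∏ j ∈ C, pairRatio p q G i j := by
  classical
  have h1 : ∏ i ∈ C, ∏ j ∈ C, pairRatio p q G i j =
      ∏ e : Fin n × Fin n, if e ∈ C ×ˢ C then pairRatio p q G e.1 e.2 else 1 := by
    rw [← Finset.prod_product', ← Finset.prod_filter]
    congr 1
    ext e
    simp
  rw [h1, prod_offDiag_eq_prod_edge _ (by simp [pairRatio]), graphProb_eq_prod,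
    graphProb_eq_prod, ← Finset.prod_pow, ← Finset.prod_pow, ← Finset.prod_mul_distrib]
  refine Fintype.prod_congr _ _ fun e => ?_
  have hne := e.2.ne
  have hq0 := hq.ne'
  have hq1' : 1 - q ≠ 0 := by linarith
  have hs : pairRatio p q G e.1.2 e.1.1 = pairRatio p q G e.1.1 e.1.2 := pairRatio_comm _ _ _
  by_cases h1 : e.1.1 ∈ C <;> by_cases h2 : e.1.2 ∈ C <;> by_cases hG : G.Adj e.1.1 e.1.2 <;>
    simp [edgeWeight, graphEquiv, edgeProb, h1, h2, hG, hs] <;>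
    simp [pairRatio, hne, hG] <;> field_simp

theorem prod_pairRatio {G : SimpleGraph (Fin n)} {i : Fin n} {D : Finset (Fin n)} (hi : i ∉ D) :
    ∏ k ∈ D, pairRatio p q G i k =
      (p / q) ^ degIn G i D * ((1 - p) / (1 - q)) ^ (D.card - degIn G i D) := by
  classical
  have h : ∀ k ∈ D, pairRatio p q G i k =
      if G.Adj i k then p / q else (1 - p) / (1 - q) := by
    intro k hk
    rw [pairRatio, if_neg (fun e : i = k => hi (e ▸ hk))]
  rw [Finset.prod_congr rfl h, Finset.prod_ite, Finset.prod_const, Finset.prod_const]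
  congr 2
  have := Finset.card_filter_add_card_filter_not (s := D) (fun k => G.Adj i k)
  rw [degIn]
  omega

theorem degIn_le_card (G : SimpleGraph (Fin n)) (i : Fin n) (D : Finset (Fin n)) :
    degIn G i D ≤ D.card := by
  classical
  exact Finset.card_filter_le _ _

theorem degIn_mono (G : SimpleGraph (Fin n)) (i : Fin n) {D D' : Finset (Fin n)} (h : D ⊆ D') :
    degIn G i D ≤ degIn G i D' := by
  classical
  exact Finset.card_le_card (Finset.filter_subset_filter _ h)

/-- Exchanging a node for one with at least as many neighbours in the rest of the community does not
decrease the likelihood of the graph. -/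
theorem graphProb_insert_le (hq : 0 < q) (hqp : q ≤ p) (hp1 : p < 1) {G : SimpleGraph (Fin n)}
    {i j : Fin n} {D : Finset (Fin n)} (hi : i ∉ D) (hj : j ∉ D)
    (h : degIn G i D ≤ degIn G j D) :
    graphProb p q (insert i D) G ≤ graphProb p q (insert j D) G := by
  classical
  have hq1 : q < 1 := hqp.trans_lt hp1
  have hu : 1 ≤ p / q := (one_le_div hq).2 hqp
  have hv0 : 0 ≤ (1 - p) / (1 - q) := div_nonneg (by linarith) (by linarith)
  have hv1 : (1 - p) / (1 - q) ≤ 1 := (div_le_one (by linarith)).2 (by linarith)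
  have hnn : ∀ a b, 0 ≤ pairRatio p q G a b := by
    intro a b
    unfold pairRatio
    split_ifs <;> linarith
  -- Only the ratios between `k` and `D` depend on `k`. Because `p / q ≥ 1 ≥ (1 - p) / (1 - q)`,
  -- their product increases with the degree of `k` into `D`.
  have expand : ∀ k ∉ D, ∏ a ∈ insert k D, ∏ b ∈ insert k D, pairRatio p q G a b =
      (∏ b ∈ D, pairRatio p q G k b) ^ 2 * ∏ a ∈ D, ∏ b ∈ D, pairRatio p q G a b := by
    intro k hk
    simp only [Finset.prod_insert hk, Finset.prod_mul_distrib]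
    have : pairRatio p q G k k = 1 := by simp [pairRatio]
    simp only [this, pairRatio_comm G _ k]
    ring
  refine le_of_sq_le_sq ?_ (graphProb_nonneg (by linarith) hp1.le hq.le hq1.le G)
  rw [graphProb_sq (C := insert i D) hq hq1, graphProb_sq (C := insert j D) hq hq1, expand i hi, expand j hj, prod_pairRatio hi,
    prod_pairRatio hj]
  refine mul_le_mul_of_nonneg_left (mul_le_mul_of_nonneg_right ?_ ?_) (sq_nonneg _)
  · have hpos : 0 ≤ p / q := by linarith
    refine pow_le_pow_left₀ (by positivity) ?_ 2
    have hle := degIn_le_card G j D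
    rw [show D.card - degIn G i D = (degIn G j D - degIn G i D) + (D.card - degIn G j D) by omega,
      pow_add, ← mul_assoc]
    refine mul_le_mul_of_nonneg_right ?_ (by positivity)
    rw [show (p / q) ^ degIn G j D =
      (p / q) ^ degIn G i D * (p / q) ^ (degIn G j D - degIn G i D) by rw [← pow_add]; congr 1; omega]
    refine mul_le_mul_of_nonneg_left ?_ (by positivity)
    exact (pow_le_one₀ hv0 hv1).trans (one_le_pow₀ hu)
  · exact Finset.prod_nonneg fun a _ => Finset.prod_nonneg fun b _ => hnn a b

theorem sideProb_swap {Y : Fin n → Outcome L} {i j : Fin n} {D : Finset (Fin n)} (hi : i ∉ D)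
    (hj : j ∉ D) (hY : Y i = Y j) :
    sideProb F (insert i D) Y = sideProb F (insert j D) Y := by
  rw [sideProb_eq_prod, sideProb_eq_prod, ← Equiv.prod_comp (Equiv.swap i j)]
  refine Fintype.prod_congr _ _ fun k => ?_
  rcases eq_or_ne k i with rfl | hki
  · rw [Equiv.swap_apply_left, ← hY]
    rcases eq_or_ne k j with rfl | hkj
    · rfl
    · simp [nodeLik, hkj, hkj.symm, hi, hj]
  · rcases eq_or_ne k j with rfl | hkj
    · rw [Equiv.swap_apply_right, hY]
      simp [nodeLik]
    · rw [Equiv.swap_apply_of_ne_of_ne hki hkj]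
      simp [nodeLik, hki, hkj]

/-- Some node of the community can be exchanged for a node outside with the same outcome and at
least as many neighbours in the rest of the community. -/
def Swappable (G : SimpleGraph (Fin n)) (Y : Fin n → Outcome L) (C : Finset (Fin n)) : Prop :=
  ∃ i ∈ C, ∃ j ∉ C, Y i = Y j ∧ degIn G i (C.erase i) ≤ degIn G j (C.erase i)

theorem Swappable.exists_le (hq : 0 < q) (hqp : q ≤ p) (hp1 : p < 1) {G : SimpleGraph (Fin n)}
    {Y : Fin n → Outcome L} (h : Swappable G Y C) :
    ∃ D : Finset (Fin n), D.card = C.card ∧ D ≠ C ∧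
      modelProb F p q C (G, Y) ≤ modelProb F p q D (G, Y) := by
  obtain ⟨i, hi, j, hj, hY, hd⟩ := h
  have hi' : i ∉ C.erase i := Finset.notMem_erase i C
  have hj' : j ∉ C.erase i := fun h => hj (Finset.mem_of_mem_erase h)
  refine ⟨insert j (C.erase i), ?_, ?_, ?_⟩
  · rw [Finset.card_insert_of_notMem hj', Finset.card_erase_add_one hi]
  · exact fun h => hj (h ▸ Finset.mem_insert_self _ _)
  · have h1 := graphProb_insert_le hq hqp hp1 hi' hj' hd
    have h2 := sideProb_swap (F := F) hi' hj' hY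
    rw [Finset.insert_erase hi] at h1 h2
    simp only [modelProb, h2]
    exact mul_le_mul_of_nonneg_right h1 (sideProb_nonneg _)

/-- For fixed data the estimator names one set. If that set is swappable, another set is at least as
likely and is missed. Summing over the data, correct guesses at swappable communities weigh no more
than errors. With success probability `s` this says `s - κ ≤ 1 - s`. -/
theorem successProb_le_of_swappable (hq : 0 < q) (hqp : q ≤ p) (hp1 : p < 1) {K : ℕ} (hK : K ≤ n)
    (est : Estimator L n) {κ : ℝ}
    (h : ∀ C : Finset (Fin n), C.card = K →
      wprob (modelProb F p q C) (fun ω => ¬ Swappable ω.1 ω.2 C) ≤ κ) :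
    successProb F n K p q est ≤ (1 + κ) / 2 := by
  classical
  have hp : 0 ≤ p := by linarith
  have hq1 : q ≤ 1 := by linarith
  have hw : ∀ (C : Finset (Fin n)) (ω : SimpleGraph (Fin n) × (Fin n → Outcome L)),
    0 ≤ modelProb F p q C ω := fun C => modelProb_nonneg hp hp1.le hq.le hq1
  have hpos : (0 : ℝ) < n.choose K := by exact_mod_cast Nat.choose_pos hK
  set 𝒞 := Finset.powersetCard K (Finset.univ : Finset (Fin n)) with h𝒞
  have hcard : (𝒞.card : ℝ) = n.choose K := by simp [h𝒞]
  have hmem : ∀ C, C ∈ 𝒞 ↔ C.card = K := fun C => by simp [h𝒞, Finset.mem_powersetCard]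
  have hexch : ∑ C ∈ 𝒞, wprob (modelProb F p q C)
        (fun ω => est ω.1 ω.2 = C ∧ Swappable ω.1 ω.2 C) ≤
      ∑ C ∈ 𝒞, wprob (modelProb F p q C) (fun ω => ¬ est ω.1 ω.2 = C) := by
    simp only [wprob]
    rw [Finset.sum_comm, Finset.sum_comm (s := 𝒞)]
    refine Finset.sum_le_sum fun ω _ => ?_
    have hnn : ∀ C ∈ 𝒞, 0 ≤ @ite ℝ (¬ est ω.1 ω.2 = C) (Classical.propDecidable _)
        (modelProb F p q C ω) 0 := by
      intro C _
      split_ifs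
      exacts [le_rfl, hw C ω]
    by_cases hc : est ω.1 ω.2 ∈ 𝒞 ∧ Swappable ω.1 ω.2 (est ω.1 ω.2)
    · obtain ⟨D, hD1, hD2, hD3⟩ := hc.2.exists_le (F := F) hq hqp hp1
      rw [Finset.sum_eq_single_of_mem _ hc.1 fun C _ hC => by simp [hC.symm]]
      rw [if_pos ⟨rfl, hc.2⟩]
      refine hD3.trans ?_
      have hDm : D ∈ 𝒞 := (hmem D).2 (hD1.trans ((hmem _).1 hc.1))
      refine le_trans ?_ (Finset.single_le_sum hnn hDm)
      rw [if_pos hD2.symm]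
    · rw [Finset.sum_eq_zero]
      · exact Finset.sum_nonneg hnn
      · intro C hC
        rw [if_neg]
        rintro ⟨rfl, hs⟩
        exact hc ⟨hC, hs⟩
  have hsplit : ∀ C ∈ 𝒞, wprob (modelProb F p q C) (fun ω => est ω.1 ω.2 = C) ≤
      wprob (modelProb F p q C) (fun ω => est ω.1 ω.2 = C ∧ Swappable ω.1 ω.2 C) + κ := by
    intro C hC
    refine (wprob_mono (hw C) fun ω hω => ?_).trans ((wprob_or_le (hw C)).trans
      (add_le_add_right (h C ((hmem C).1 hC)) _))
    by_cases hs : Swappable ω.1 ω.2 C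
    exacts [Or.inl ⟨hω, hs⟩, Or.inr hs]
  have hnot : ∀ C ∈ 𝒞, wprob (modelProb F p q C) (fun ω => ¬ est ω.1 ω.2 = C) =
      1 - wprob (modelProb F p q C) (fun ω => est ω.1 ω.2 = C) := by
    intro C _
    rw [wprob_not, sum_modelProb]
  have h1 := Finset.sum_le_sum hsplit
  rw [Finset.sum_congr rfl hnot] at hexch
  rw [Finset.sum_sub_distrib] at hexch
  rw [Finset.sum_add_distrib] at h1
  simp only [Finset.sum_const, nsmul_eq_mul, hcard, mul_one] at h1 hexch
  rw [successProb_eq, div_le_div_iff₀ hpos two_pos]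
  linarith

/-- An unordered pair from `i` into `D` that is also one from `j` into `D` would have to be `{i,
j}`, with `j` in `D`. -/
theorem wprob_degIn_and_degIn {i j : Fin n} {D : Finset (Fin n)} (hij : i ≠ j) (hj : j ∉ D)
    (P Q : ℕ → Prop) :
    wprob (graphProb p q C) (fun G => P (degIn G i D) ∧ Q (degIn G j D)) =
      wprob (graphProb p q C) (fun G => P (degIn G i D)) *
        wprob (graphProb p q C) (fun G => Q (degIn G j D)) := by
  refine wprob_graph_and {e | e.1 = i ∧ e.2 ∈ D} (fun G H h => ?_) (fun G H h => ?_)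
  · rw [degIn_congr fun k hk => h i k (Or.inl ⟨rfl, hk⟩)]
  · rw [degIn_congr fun k hk => h j k (fun e => hij e.1.symm) (fun e => hj e.2)]

/-- Low degrees at two community nodes interact only through the pair joining them. Removing both
nodes from `C` gives independent events, and each original event is at least `1 - p` times as likely
as its reduced version: require the pair to be non-adjacent. So the correlation factor is at most
`(1 - p)⁻²`, which `hcp` bounds by `1 + c`. The expected number is bounded below by a single
binomial point probability. -/
theorem wprob_forall_inside_le (hp : 0 ≤ p) (hp1 : p ≤ 1) (hq : 0 ≤ q) (hq1 : q ≤ 1)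
    (o : Outcome L) (m : ℕ) {c x : ℝ} (hc : 0 ≤ c) (hcp : 1 ≤ (1 + c) * (1 - p) ^ 2) (hx : 0 < x)
    (hxμ : x ≤ C.card * (insideLik F n o *
      ((C.card - 1).choose m * p ^ m * (1 - p) ^ (C.card - 1 - m)))) :
    wprob (modelProb F p q C) (fun ω => ∀ i ∈ C, ¬ (degIn ω.1 i C ≤ m ∧ ω.2 i = o)) ≤
      1 / x + c := by
  classical
  have hw := modelProb_nonneg (F := F) (C := C) hp hp1 hq hq1
  have hg := graphProb_nonneg (C := C) hp hp1 hq hq1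
  have hA : ∀ i ∈ C, wprob (modelProb F p q C) (fun ω => degIn ω.1 i C ≤ m ∧ ω.2 i = o) =
      wprob (graphProb p q C) (fun G => degIn G i C ≤ m) * insideLik F n o := by
    intro i hi
    rw [wprob_modelProb_and (fun G => degIn G i C ≤ m) (fun Y => Y i = o), wprob_sideProb_eq,
      nodeLik, if_pos hi]
  have herase : ∀ (G : SimpleGraph (Fin n)) (i : Fin n), degIn G i C = degIn G i (C.erase i) := by
    intro G i
    rw [degIn, degIn]
    congr 1
    ext k
    simp only [Finset.mem_filter, Finset.mem_erase]
    exact ⟨fun h => ⟨⟨h.2.ne', h.1⟩, h.2⟩, fun h => ⟨h.1.2, h.2⟩⟩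
  have hlow : x ≤ ∑ i ∈ C,
      wprob (modelProb F p q C) (fun ω => degIn ω.1 i C ≤ m ∧ ω.2 i = o) := by
    refine hxμ.trans ?_
    rw [← nsmul_eq_mul]
    refine Finset.card_nsmul_le_sum _ _ _ fun i hi => ?_
    rw [hA i hi, mul_comm]
    refine mul_le_mul_of_nonneg_right ?_ (insideLik_nonneg o)
    rw [← Finset.card_erase_of_mem hi,
      ← wprob_degIn_eq (p := p) (q := q) (C := C) (C.erase i) (Finset.notMem_erase i C)
      (fun k hk => by simp [edgeProb, hi, Finset.mem_of_mem_erase hk])]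
    exact wprob_mono hg fun G hG => by rw [herase, hG]
  refine (wprob_forall_not_le hw sum_modelProb C
    (fun i ω => degIn ω.1 i C ≤ m ∧ ω.2 i = o) hc ?_ (hx.trans_le hlow)).trans ?_
  · intro i hi j hj hij
    let D := (C.erase i).erase j
    have hiD : i ∉ D := fun h => Finset.notMem_erase i C (Finset.mem_of_mem_erase h)
    have hjD : j ∉ D := Finset.notMem_erase j _
    have hDC : D ⊆ C := (Finset.erase_subset _ _).trans (Finset.erase_subset _ _)
    have hjoint : wprob (modelProb F p q C)
        (fun ω => (degIn ω.1 i C ≤ m ∧ ω.2 i = o) ∧ (degIn ω.1 j C ≤ m ∧ ω.2 j = o)) =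
        wprob (graphProb p q C) (fun G => degIn G i C ≤ m ∧ degIn G j C ≤ m) *
          (insideLik F n o * insideLik F n o) := by
      rw [wprob_congr (fun ω => and_and_and_comm),
        wprob_modelProb_and (fun G => degIn G i C ≤ m ∧ degIn G j C ≤ m)
          (fun Y => Y i = o ∧ Y j = o), wprob_sideProb_eq_and hij, nodeLik, nodeLik, if_pos hi,
        if_pos hj]
    have hupper : wprob (graphProb p q C) (fun G => degIn G i C ≤ m ∧ degIn G j C ≤ m) ≤
        wprob (graphProb p q C) (fun G => degIn G i D ≤ m) *
        wprob (graphProb p q C) (fun G => degIn G j D ≤ m) := by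
      rw [← wprob_degIn_and_degIn hij hjD (fun k => k ≤ m) fun k => k ≤ m]
      exact wprob_mono hg fun G hG =>
        ⟨(degIn_mono G i hDC).trans hG.1, (degIn_mono G j hDC).trans hG.2⟩
    have hlower : ∀ k l : Fin n, k ∈ C → l ∈ C → k ≠ l → k ∉ D → l ∉ D →
        (∀ G : SimpleGraph (Fin n), ¬ G.Adj k l → degIn G k C ≤ degIn G k D) →
        (1 - p) * wprob (graphProb p q C) (fun G => degIn G k D ≤ m) ≤
          wprob (graphProb p q C) (fun G => degIn G k C ≤ m) := by
      intro k l hk hl hkl hkD hlD hle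
      have := wprob_degIn_and (p := p) (q := q) (C := C) hkD hlD (fun P => ¬ P) fun d => d ≤ m
      rw [wprob_not_adj hkl, edgeProb, if_pos ⟨hk, hl⟩] at this
      rw [← this]
      exact wprob_mono hg fun G hG => (hle G hG.1).trans hG.2
    have hi' := hlower i j hi hj hij hiD hjD fun G hG => by
      refine Finset.card_le_card fun k hk => ?_
      simp only [Finset.mem_filter, D, Finset.mem_erase] at hk ⊢
      exact ⟨⟨fun e => hG (e ▸ hk.2), hk.2.ne', hk.1⟩, hk.2⟩
    have hj' := hlower j i hj hi hij.symm hjD hiD fun G hG => by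
      refine Finset.card_le_card fun k hk => ?_
      simp only [Finset.mem_filter, D, Finset.mem_erase] at hk ⊢
      exact ⟨⟨hk.2.ne', fun e => hG (e ▸ hk.2), hk.1⟩, hk.2⟩
    rw [hjoint, hA i hi, hA j hj]
    set a := wprob (graphProb p q C) (fun G => degIn G i D ≤ m)
    set b := wprob (graphProb p q C) (fun G => degIn G j D ≤ m)
    have ha : 0 ≤ a := wprob_nonneg hg
    have hb : 0 ≤ b := wprob_nonneg hg
    have hp' : 0 ≤ 1 - p := by linarith
    have h3 := mul_le_mul hi' hj' (by positivity) (wprob_nonneg hg)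
    have hu : 0 ≤ insideLik F n o * insideLik F n o := mul_self_nonneg _
    have h4 : wprob (graphProb p q C) (fun G => degIn G i C ≤ m ∧ degIn G j C ≤ m) ≤
        (1 + c) * (wprob (graphProb p q C) (fun G => degIn G i C ≤ m) *
          wprob (graphProb p q C) (fun G => degIn G j C ≤ m)) := by
      calc _ ≤ a * b := hupper
        _ ≤ ((1 + c) * (1 - p) ^ 2) * (a * b) := le_mul_of_one_le_left (by positivity) hcp
        _ = (1 + c) * ((1 - p) * a * ((1 - p) * b)) := by ring
        _ ≤ _ := mul_le_mul_of_nonneg_left h3 (by linarith)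
    calc _ ≤ _ := mul_le_mul_of_nonneg_right h4 hu
      _ = _ := by ring
  · gcongr

/-- Degrees of distinct outside nodes into `C` use disjoint pairs, so Chebyshev applies with no
correlation error. -/
theorem wprob_forall_outside_le (hp : 0 ≤ p) (hp1 : p ≤ 1) (hq : 0 ≤ q) (hq1 : q ≤ 1)
    (o : Outcome L) (m : ℕ) {x : ℝ} (hx : 0 < x)
    (hxμ : x ≤ ((n : ℝ) - C.card) * (outsideLik F n o *
      (C.card.choose m * q ^ m * (1 - q) ^ (C.card - m)))) :
    wprob (modelProb F p q C) (fun ω => ∀ i ∈ Cᶜ, ¬ (m ≤ degIn ω.1 i C ∧ ω.2 i = o)) ≤ 1 / x := by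
  have hw := modelProb_nonneg (F := F) (C := C) hp hp1 hq hq1
  have hg := graphProb_nonneg (C := C) hp hp1 hq hq1
  have hA : ∀ i ∈ Cᶜ, wprob (modelProb F p q C) (fun ω => m ≤ degIn ω.1 i C ∧ ω.2 i = o) =
      wprob (graphProb p q C) (fun G => m ≤ degIn G i C) * outsideLik F n o := by
    intro i hi
    rw [wprob_modelProb_and (fun G => m ≤ degIn G i C) (fun Y => Y i = o), wprob_sideProb_eq,
      nodeLik, if_neg (Finset.mem_compl.1 hi)]
  have hlow : x ≤ ∑ i ∈ Cᶜ,
      wprob (modelProb F p q C) (fun ω => m ≤ degIn ω.1 i C ∧ ω.2 i = o) := by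
    refine hxμ.trans ?_
    have hcard : (n : ℝ) - C.card = Cᶜ.card := by
      rw [Finset.card_compl, Fintype.card_fin, Nat.cast_sub]
      simpa using Finset.card_le_univ C
    rw [hcard, ← nsmul_eq_mul]
    refine Finset.card_nsmul_le_sum _ _ _ fun i hi => ?_
    rw [hA i hi, mul_comm]
    refine mul_le_mul_of_nonneg_right ?_ (outsideLik_nonneg o)
    rw [← wprob_degIn_eq (p := p) (q := q) (C := C) C (Finset.mem_compl.1 hi)
      (fun k hk => by simp [edgeProb, Finset.mem_compl.1 hi])]
    exact wprob_mono hg fun G hG => hG.ge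
  refine (wprob_forall_not_le hw sum_modelProb Cᶜ
    (fun i ω => m ≤ degIn ω.1 i C ∧ ω.2 i = o) le_rfl ?_ (hx.trans_le hlow)).trans ?_
  · intro i hi j hj hij
    rw [wprob_congr (fun ω => and_and_and_comm),
      wprob_modelProb_and (fun G => m ≤ degIn G i C ∧ m ≤ degIn G j C)
        (fun Y => Y i = o ∧ Y j = o), wprob_sideProb_eq_and hij, nodeLik, nodeLik,
      if_neg (Finset.mem_compl.1 hi), if_neg (Finset.mem_compl.1 hj), hA i hi, hA j hj,
      wprob_degIn_and_degIn hij (Finset.mem_compl.1 hj) (fun k => m ≤ k) fun k => m ≤ k]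
    exact le_of_eq (by ring)
  · rw [add_zero]
    gcongr

theorem successProb_le_of_many (hq : 0 < q) (hqp : q ≤ p) (hp1 : p < 1) {K : ℕ} (hK : K ≤ n)
    (est : Estimator L n) (o : Outcome L) {m₁ m₂ : ℕ} (hm : m₁ < m₂) {c x : ℝ} (hc : 0 ≤ c)
    (hcp : 1 ≤ (1 + c) * (1 - p) ^ 2) (hx : 0 < x)
    (h₁ : x ≤ K * (insideLik F n o * ((K - 1).choose m₁ * p ^ m₁ * (1 - p) ^ (K - 1 - m₁))))
    (h₂ : x ≤ ((n : ℝ) - K) * (outsideLik F n o * (K.choose m₂ * q ^ m₂ * (1 - q) ^ (K - m₂)))) :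
    successProb F n K p q est ≤ (1 + (1 / x + c + 1 / x)) / 2 := by
  refine successProb_le_of_swappable hq hqp hp1 hK est fun C hC => ?_
  subst hC
  have hp : 0 ≤ p := by linarith
  have hq1 : q ≤ 1 := by linarith
  have hw := modelProb_nonneg (F := F) (C := C) hp hp1.le hq.le hq1
  have hin := wprob_forall_inside_le hp hp1.le hq.le hq1 o m₁ hc hcp hx h₁
  have hout := wprob_forall_outside_le hp hp1.le hq.le hq1 o m₂ hx h₂
  refine le_trans ?_ (add_le_add hin hout)
  refine (wprob_mono hw fun ω hω => ?_).trans (wprob_or_le hw)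
  by_contra hcon
  push Not at hcon
  obtain ⟨⟨i, hi, hdi, hYi⟩, j, hj, hdj, hYj⟩ := hcon
  refine hω ⟨i, hi, j, Finset.mem_compl.1 hj, hYi.trans hYj.symm, ?_⟩
  have h1 : degIn ω.1 i (C.erase i) ≤ degIn ω.1 i C :=
    degIn_mono _ _ (Finset.erase_subset _ _)
  -- Here `j` loses at most the neighbour `i`; the strict inequality `m₁ < m₂` absorbs this.
  have h2 : degIn ω.1 j C ≤ degIn ω.1 j (C.erase i) + 1 := by
    have h3 : degIn ω.1 j C ≤ degIn ω.1 j (C.erase i) + degIn ω.1 j {i} := by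
      refine degIn_le_add fun k hk => ?_
      simp only [Finset.mem_union, Finset.mem_erase, Finset.mem_singleton]
      tauto
    have h4 := degIn_le_card ω.1 j {i}
    rw [Finset.card_singleton] at h4
    omega
  omega

end Swap

/-! ### Poisson rates, binomial lower bounds and the growth regime. -/

section Asymptotics

/-- Rate function of the Poisson distribution with mean `c`. -/
noncomputable def rate (c t : ℝ) : ℝ := c - t + t * Real.log (t / c)

theorem continuousAt_rate {c t : ℝ} (hc : 0 < c) (ht : 0 < t) : ContinuousAt (rate c) t := by
  unfold rate
  have : t / c ≠ 0 := (div_pos ht hc).ne'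
  fun_prop (disch := assumption)

theorem rate_pos {c t : ℝ} (hc : 0 < c) (ht : 0 < t) (h : t ≠ c) : 0 < rate c t := by
  have h1 : c / t ≠ 1 := fun e => h ((div_eq_one_iff_eq ht.ne').1 e).symm
  have h2 := Real.log_lt_sub_one_of_pos (div_pos hc ht) h1
  rw [← inv_div, Real.log_inv] at h2
  have h3 := mul_lt_mul_of_pos_left h2 ht
  have h4 : t * ((t / c)⁻¹ - 1) = c - t := by field_simp
  unfold rate
  linarith

theorem tendsto_log_natCast : Tendsto (fun n : ℕ => Real.log n) atTop atTop :=
  Real.tendsto_log_atTop.comp tendsto_natCast_atTop_atTop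

theorem eventually_log_pos : ∀ᶠ n : ℕ in atTop, 0 < Real.log n :=
  tendsto_log_natCast.eventually_gt_atTop 0

theorem tendsto_exp_of_div_log {x : ℕ → ℝ} {c : ℝ} (hc : c < 0)
    (hx : Tendsto (fun n : ℕ => x n / Real.log n) atTop (𝓝 c)) :
    Tendsto (fun n => Real.exp (x n)) atTop (𝓝 0) := by
  refine Real.tendsto_exp_atBot.comp ?_
  refine (hx.neg_mul_atTop hc tendsto_log_natCast).congr' ?_
  filter_upwards [eventually_log_pos] with n hn
  exact div_mul_cancel₀ _ hn.ne'

theorem LogScale.tendsto_div {f : ℕ → ℝ} {c : ℝ} (h : LogScale f c) :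
    Tendsto (fun n : ℕ => f n / Real.log n) atTop (𝓝 c) := by
  have h1 := h.tendsto_div_nhds_zero.add_const c
  rw [zero_add] at h1
  refine h1.congr' ?_
  filter_upwards [eventually_log_pos] with n hn
  field_simp
  ring

theorem tendsto_log_div_self : Tendsto (fun n : ℕ => Real.log n / n) atTop (𝓝 0) :=
  Real.isLittleO_log_id_atTop.tendsto_div_nhds_zero.comp tendsto_natCast_atTop_atTop

theorem tendsto_log_sq_div_self : Tendsto (fun n : ℕ => Real.log n ^ 2 / n) atTop (𝓝 0) :=
  (Real.isLittleO_pow_log_id_atTop (n := 2)).tendsto_div_nhds_zero.comp tendsto_natCast_atTop_atTop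

theorem tendsto_log_log_div_log :
    Tendsto (fun n : ℕ => Real.log (Real.log n) / Real.log n) atTop (𝓝 0) :=
  Real.isLittleO_log_id_atTop.tendsto_div_nhds_zero.comp tendsto_log_natCast

theorem factorial_le_mul_exp {m : ℕ} (hm : 0 < m) :
    (m.factorial : ℝ) ≤ Real.exp (m * Real.log m - m + Real.log m + 1) := by
  induction m, hm using Nat.le_induction with
  | base => simp
  | succ k hk ih =>
    have hk0 : (0 : ℝ) < k := by exact_mod_cast hk
    rw [Nat.factorial_succ]
    push_cast
    have hlog : (k + 1 : ℝ) = Real.exp (Real.log (k + 1)) := (Real.exp_log (by positivity)).symm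
    calc ((k : ℝ) + 1) * k.factorial ≤ Real.exp (Real.log (k + 1)) *
          Real.exp (k * Real.log k - k + Real.log k + 1) := by
            rw [← hlog]
            gcongr
      _ = Real.exp (Real.log (k + 1) + (k * Real.log k - k + Real.log k + 1)) :=
            (Real.exp_add _ _).symm
      _ ≤ _ := by
        refine Real.exp_le_exp.2 ?_
        -- The induction step amounts to `(k + 1) log (k / (k + 1)) ≤ -1`.
        have h1 : Real.log ((k : ℝ) / (k + 1)) ≤ (k : ℝ) / (k + 1) - 1 :=
          Real.log_le_sub_one_of_pos (by positivity)
        rw [Real.log_div hk0.ne' (by positivity)] at h1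
        have h2 := mul_le_mul_of_nonneg_left h1 (by positivity : (0 : ℝ) ≤ k + 1)
        have h3 : ((k : ℝ) + 1) * (k / (k + 1) - 1) = -1 := by field_simp; ring
        linarith

/-- From `N.choose m ≥ (N - m) ^ m / m!`, the factorial bound above, and `(1 - r) ^ (N - m) ≥ (1 -
r) ^ N`. -/
theorem exp_le_binomial {N m : ℕ} (hm : 0 < m) (hmN : m < N) {r : ℝ} (hr : 0 < r) (hr1 : r < 1) :
    Real.exp (m * Real.log (((N : ℝ) - m) * r / m) + m - Real.log m - 1 + N * Real.log (1 - r)) ≤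
      N.choose m * r ^ m * (1 - r) ^ (N - m) := by
  have hm0 : (0 : ℝ) < m := by exact_mod_cast hm
  have hNm : (0 : ℝ) < (N : ℝ) - m := sub_pos.2 (by exact_mod_cast hmN)
  have h1 : ((N : ℝ) - m) ^ m ≤ m.factorial * N.choose m := by
    have := Nat.pow_sub_le_descFactorial N m
    rw [Nat.descFactorial_eq_factorial_mul_choose] at this
    have h2 : ((N + 1 - m : ℕ) : ℝ) ^ m ≤ m.factorial * N.choose m := by exact_mod_cast this
    refine le_trans (pow_le_pow_left₀ hNm.le ?_ m) h2
    rw [← Nat.cast_sub hmN.le]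
    exact_mod_cast (by omega)
  have h2 : ((N : ℝ) - m) ^ m ≤
      Real.exp (m * Real.log m - m + Real.log m + 1) * N.choose m :=
    h1.trans (mul_le_mul_of_nonneg_right (factorial_le_mul_exp hm) (Nat.cast_nonneg _))
  have h3 : Real.exp (N * Real.log (1 - r)) ≤ (1 - r) ^ (N - m) := by
    rw [Real.exp_nat_mul, Real.exp_log (by linarith)]
    exact pow_le_pow_of_le_one (by linarith) (by linarith) (Nat.sub_le _ _)
  have h4 : Real.exp (m * Real.log (((N : ℝ) - m) * r / m) + m - Real.log m - 1) ≤
      N.choose m * r ^ m := by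
    have e1 : m * Real.log (((N : ℝ) - m) * r / m) + m - Real.log m - 1 =
        m * Real.log (((N : ℝ) - m) * r) - (m * Real.log m - m + Real.log m + 1) := by
      rw [Real.log_div (by positivity) hm0.ne']
      ring
    rw [e1, Real.exp_sub, div_le_iff₀ (Real.exp_pos _), Real.exp_nat_mul,
      Real.exp_log (by positivity), mul_pow]
    have := mul_le_mul_of_nonneg_right h2 (pow_nonneg hr.le m)
    linarith
  rw [Real.exp_add]
  exact mul_le_mul h4 h3 (Real.exp_pos _).le (by positivity)

/-- Lower large-deviation bound for binomial point probabilities on the logarithmic scale. -/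
theorem eventually_exp_le_binomial {N m : ℕ → ℕ} {r : ℕ → ℝ} {c s x : ℝ} (hc : 0 < c) (hs : 0 < s)
    (hr : ∀ᶠ n in atTop, 0 < r n) (hr0 : Tendsto r atTop (𝓝 0))
    (hN : Tendsto (fun n => r n * N n / Real.log n) atTop (𝓝 c))
    (hm : Tendsto (fun n => m n / Real.log n) atTop (𝓝 s)) (hx : x < -rate c s) :
    ∀ᶠ n : ℕ in atTop, Real.exp (x * Real.log n) ≤
      (N n).choose (m n) * r n ^ m n * (1 - r n) ^ (N n - m n) := by
  have hmtop : Tendsto (fun n => (m n : ℝ)) atTop atTop := by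
    refine (hm.pos_mul_atTop hs tendsto_log_natCast).congr' ?_
    filter_upwards [eventually_log_pos] with n hn
    exact div_mul_cancel₀ _ hn.ne'
  have hmr : Tendsto (fun n => r n * m n / Real.log n) atTop (𝓝 0) := by
    have := hr0.mul hm
    rw [zero_mul] at this
    exact this.congr fun n => by ring
  have hmean : Tendsto (fun n => ((N n : ℝ) - m n) * r n / m n) atTop (𝓝 (c / s)) := by
    have h1 := (hN.sub hmr).div hm hs.ne'
    rw [sub_zero] at h1
    refine h1.congr' ?_
    filter_upwards [eventually_log_pos, hmtop.eventually_gt_atTop 0] with n hn hm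
    simp only [Pi.div_apply]
    field_simp
  have hlt : ∀ᶠ n in atTop, (m n : ℝ) < N n := by
    filter_upwards [hmean.eventually_const_lt (div_pos hc hs), hr,
      hmtop.eventually_gt_atTop 0] with n h1 h2 h3
    have h4 : 0 < ((N n : ℝ) - m n) * r n := by
      have := mul_pos h1 h3
      rwa [div_mul_cancel₀ _ h3.ne'] at this
    exact sub_pos.1 (pos_of_mul_pos_left h4 h2.le)
  -- Squeezed by `1 - y⁻¹ ≤ log y ≤ y - 1` at `y = 1 - r n`.
  have hlogr : Tendsto (fun n => N n * Real.log (1 - r n) / Real.log n) atTop (𝓝 (-c)) := by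
    have hup : Tendsto (fun n => -(r n * N n / Real.log n)) atTop (𝓝 (-c)) := hN.neg
    have hlo : Tendsto (fun n => -(r n * N n / Real.log n) * (1 - r n)⁻¹) atTop (𝓝 (-c)) := by
      have := hup.mul ((hr0.const_sub 1).inv₀ (by norm_num))
      simpa using this
    refine tendsto_of_tendsto_of_tendsto_of_le_of_le' hlo hup ?_ ?_
    · filter_upwards [eventually_log_pos, hr0.eventually_lt_const (zero_lt_one)] with n h1 h2
      have h3 : 0 < 1 - r n := by linarith
      have h4 := Real.one_sub_inv_le_log_of_pos h3
      have h5 : -(r n * N n / Real.log n) * (1 - r n)⁻¹ =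
          N n * (1 - (1 - r n)⁻¹) / Real.log n := by
        field_simp
        ring
      rw [h5]
      gcongr
    · filter_upwards [eventually_log_pos, hr0.eventually_lt_const (zero_lt_one)] with n h1 h2
      have h3 : 0 < 1 - r n := by linarith
      have h4 := Real.log_le_sub_one_of_pos h3
      have h5 : -(r n * N n / Real.log n) = N n * (-r n) / Real.log n := by ring
      rw [h5]
      gcongr
      linarith
  have hlogm : Tendsto (fun n => Real.log (m n) / Real.log n) atTop (𝓝 0) := by
    have h1 := (Real.isLittleO_log_id_atTop.tendsto_div_nhds_zero.comp hmtop).mul hm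
    rw [zero_mul] at h1
    refine h1.congr' ?_
    filter_upwards [eventually_log_pos, hmtop.eventually_gt_atTop 0] with n h1 h2
    simp only [Function.comp_apply, id]
    field_simp
  have hone : Tendsto (fun n : ℕ => 1 / Real.log n) atTop (𝓝 0) :=
    tendsto_const_nhds.div_atTop tendsto_log_natCast
  have hexp : Tendsto (fun n => (m n * Real.log (((N n : ℝ) - m n) * r n / m n) + m n -
      Real.log (m n) - 1 + N n * Real.log (1 - r n)) / Real.log n) atTop (𝓝 (-rate c s)) := by
    have h1 := ((((hm.mul (hmean.log (div_pos hc hs).ne')).add hm).sub hlogm).sub hone).add hlogr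
    have h2 : s * Real.log (c / s) + s - 0 - 0 + -c = -rate c s := by
      rw [rate, ← inv_div c s, Real.log_inv]
      ring
    rw [h2] at h1
    refine h1.congr fun n => ?_
    ring
  filter_upwards [hexp.eventually_const_lt hx, eventually_log_pos, hlt, hr,
    hmtop.eventually_gt_atTop 0, hr0.eventually_lt_const (zero_lt_one)] with n h1 h2 h3 h4 h5 h6
  refine le_trans (Real.exp_le_exp.2 ((lt_div_iff₀ h2).1 h1).le) ?_
  exact exp_le_binomial (by exact_mod_cast h5) (by exact_mod_cast h3) h4 h6

/-- Combine `n.choose K ≤ n ^ K / K!` with `K ^ K / K! ≤ exp K`. Since `log (n / K) = o(log n)` in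
the regime below, there are only `exp (o(K log n))` candidate sets. -/
theorem choose_le_exp {n K : ℕ} (hK : 0 < K) (hKn : K ≤ n) :
    (n.choose K : ℝ) ≤ Real.exp (K * (1 + Real.log (n / K))) := by
  have hK0 : (0 : ℝ) < K := by exact_mod_cast hK
  have hn0 : (0 : ℝ) < n := hK0.trans_le (by exact_mod_cast hKn)
  have h1 : (n.choose K : ℝ) ≤ (n : ℝ) ^ K / K.factorial := Nat.choose_le_pow_div K n
  have h2 := Real.pow_div_factorial_le_exp (K : ℝ) hK0.le K
  refine h1.trans ?_
  rw [Real.exp_nat_mul, Real.exp_add, Real.exp_log (by positivity), mul_pow, ← Real.exp_nat_mul,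
    mul_one, div_pow]
  calc (n : ℝ) ^ K / K.factorial = (K : ℝ) ^ K / K.factorial * (n ^ K / K ^ K) := by
        field_simp
    _ ≤ _ := by gcongr

/-- The growth rates of community size and edge probabilities. -/
structure LogRegime (ρ a b : ℝ) (K : ℕ → ℕ) (p q : ℕ → ℝ) : Prop where
  rho_pos : 0 < ρ
  b_pos : 0 < b
  b_lt_a : b < a
  tendsto_log_size : Tendsto (fun n => Real.log (K n) / Real.log n) atTop (𝓝 1)
  tendsto_size_div : Tendsto (fun n => (K n : ℝ) / n) atTop (𝓝 0)
  tendsto_p_mul : Tendsto (fun n => p n * K n / Real.log n) atTop (𝓝 (ρ * a))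
  tendsto_q_mul : Tendsto (fun n => q n * K n / Real.log n) atTop (𝓝 (ρ * b))
  tendsto_p : Tendsto p atTop (𝓝 0)
  tendsto_q : Tendsto q atTop (𝓝 0)
  q_pos : ∀ᶠ n in atTop, 0 < q n
  q_le_p : ∀ᶠ n in atTop, q n ≤ p n

theorem LogRegime.of_eventually {ρ a b : ℝ} (hρ : 0 < ρ) (hb : 0 < b) (hab : b < a)
    {K : ℕ → ℕ} {p q : ℕ → ℝ}
    (hK : ∀ᶠ n : ℕ in atTop, |(K n : ℝ) - ρ * n / Real.log n| < 1)
    (hp : ∀ᶠ n : ℕ in atTop, p n = a * Real.log n ^ 2 / n)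
    (hq : ∀ᶠ n : ℕ in atTop, q n = b * Real.log n ^ 2 / n) : LogRegime ρ a b K p q := by
  have hn : ∀ᶠ n : ℕ in atTop, (0 : ℝ) < n := by
    filter_upwards [eventually_gt_atTop 0] with n hn
    exact_mod_cast hn
  have hKn : Tendsto (fun n : ℕ => K n * Real.log n / n) atTop (𝓝 ρ) := by
    have h1 : Tendsto (fun n : ℕ => K n * Real.log n / n - ρ) atTop (𝓝 0) := by
      refine squeeze_zero_norm' ?_ tendsto_log_div_self
      filter_upwards [hK, eventually_log_pos, hn] with n h1 h2 h3
      have h4 : K n * Real.log n / n - ρ = (K n - ρ * n / Real.log n) * (Real.log n / n) := by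
        field_simp
      rw [h4, norm_mul, Real.norm_eq_abs, Real.norm_of_nonneg (by positivity)]
      exact mul_le_of_le_one_left (by positivity) h1.le
    simpa using h1.add_const ρ
  have hmean : ∀ {r : ℕ → ℝ} {c : ℝ}, (∀ᶠ n : ℕ in atTop, r n = c * Real.log n ^ 2 / n) →
      Tendsto (fun n => r n * K n / Real.log n) atTop (𝓝 (ρ * c)) := by
    intro r c hr
    refine (hKn.mul_const c).congr' ?_
    filter_upwards [hr, eventually_log_pos, hn] with n h1 h2 h3
    rw [h1]
    field_simp
  have hzero : ∀ {r : ℕ → ℝ} {c : ℝ}, (∀ᶠ n : ℕ in atTop, r n = c * Real.log n ^ 2 / n) →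
      Tendsto r atTop (𝓝 0) := by
    intro r c hr
    have h1 := tendsto_log_sq_div_self.const_mul c
    rw [mul_zero] at h1
    refine h1.congr' ?_
    filter_upwards [hr] with n h1
    rw [h1]
    ring
  refine ⟨hρ, hb, hab, ?_, ?_, hmean hp, hmean hq, hzero hp, hzero hq, ?_, ?_⟩
  · have h1 : Tendsto (fun n : ℕ => 1 - Real.log (Real.log n) / Real.log n +
        Real.log (K n * Real.log n / n) / Real.log n) atTop (𝓝 (1 - 0 + 0)) :=
      (tendsto_log_log_div_log.const_sub 1).add
        ((hKn.log hρ.ne').div_atTop tendsto_log_natCast)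
    rw [sub_zero, add_zero] at h1
    refine h1.congr' ?_
    filter_upwards [hKn.eventually_const_lt hρ, eventually_log_pos, hn] with n h1 h2 h3
    have hK0 : (K n : ℝ) ≠ 0 := by
      rintro h
      simp [h] at h1
    rw [Real.log_div (by positivity) h3.ne', Real.log_mul hK0 h2.ne']
    field_simp
    ring
  · refine (hKn.div_atTop tendsto_log_natCast).congr' ?_
    filter_upwards [eventually_log_pos] with n h1
    field_simp
  · filter_upwards [hq, eventually_log_pos, hn] with n h1 h2 h3
    rw [h1]
    positivity
  · filter_upwards [hp, hq, eventually_log_pos, hn] with n h0 h1 h2 h3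
    rw [h0, h1]
    gcongr

namespace LogRegime

variable {ρ a b : ℝ} {K : ℕ → ℕ} {p q : ℕ → ℝ}

theorem tendsto_size (h : LogRegime ρ a b K p q) : Tendsto (fun n => (K n : ℝ)) atTop atTop := by
  have h1 : Tendsto (fun n => Real.log (K n)) atTop atTop := by
    refine (h.tendsto_log_size.pos_mul_atTop one_pos tendsto_log_natCast).congr' ?_
    filter_upwards [eventually_log_pos] with n hn
    exact div_mul_cancel₀ _ hn.ne'
  refine tendsto_atTop_mono' _ ?_ h1
  filter_upwards with n
  exact (Real.log_le_self (Nat.cast_nonneg _))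

theorem eventually_size_le (h : LogRegime ρ a b K p q) : ∀ᶠ n in atTop, K n ≤ n := by
  filter_upwards [h.tendsto_size_div.eventually_lt_const one_pos, eventually_gt_atTop 0]
    with n h1 h2
  have : (0 : ℝ) < n := by exact_mod_cast h2
  exact_mod_cast ((div_lt_one this).1 h1).le

theorem tendsto_log_div_size (h : LogRegime ρ a b K p q) :
    Tendsto (fun n : ℕ => Real.log (n / K n) / Real.log n) atTop (𝓝 0) := by
  have h1 := h.tendsto_log_size.const_sub 1
  rw [sub_self] at h1
  refine h1.congr' ?_
  filter_upwards [eventually_log_pos, eventually_gt_atTop 0, h.tendsto_size.eventually_gt_atTop 0]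
    with n h1 h2 h3
  rw [Real.log_div (by positivity) h3.ne']
  field_simp

theorem eventually_probs (h : LogRegime ρ a b K p q) :
    ∀ᶠ n in atTop, 0 < q n ∧ q n ≤ p n ∧ p n < 1 := by
  filter_upwards [h.q_pos, h.q_le_p, h.tendsto_p.eventually_lt_const one_pos] with n h1 h2 h3
  exact ⟨h1, h2, h3⟩

theorem tendsto_p_mul_pred (h : LogRegime ρ a b K p q) :
    Tendsto (fun n => p n * ((K n - 1 : ℕ) : ℝ) / Real.log n) atTop (𝓝 (ρ * a)) := by
  have h1 := h.tendsto_p_mul.sub (h.tendsto_p.div_atTop tendsto_log_natCast)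
  rw [sub_zero] at h1
  refine h1.congr' ?_
  filter_upwards [h.tendsto_size.eventually_gt_atTop 0] with n hn
  rw [Nat.cast_pred (by exact_mod_cast hn)]
  ring

end LogRegime

end Asymptotics

/-! ### The six thresholds as one exponent. -/

section Thresholds

variable {M : ℕ} {L : Fin M → ℕ} {F : Features L} {ρ a b τ : ℝ} {l : ℕ → Outcome L}

theorem eventually_exp_f2_eq (h : EventuallyPositive F l) :
    ∀ᶠ n in atTop, insideLik F n (l n) = Real.exp (f2 F l n) := by
  filter_upwards [h] with n hn
  rw [f2, Real.exp_sum, insideLik]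
  exact Finset.prod_congr rfl fun m _ => (Real.exp_log (hn m).1).symm

theorem eventually_exp_f3_eq (h : EventuallyPositive F l) :
    ∀ᶠ n in atTop, outsideLik F n (l n) = Real.exp (f3 F l n) := by
  filter_upwards [h] with n hn
  rw [f3, Real.exp_sum, outsideLik]
  exact Finset.prod_congr rfl fun m _ => (Real.exp_log (hn m).2).symm

theorem eventually_f1_eq (h : EventuallyPositive F l) :
    ∀ᶠ n in atTop, f1 F l n = f2 F l n - f3 F l n := by
  filter_upwards [h] with n hn
  rw [f1, f2, f3, ← Finset.sum_sub_distrib]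
  exact Finset.sum_congr rfl fun m _ => Real.log_div (hn m).1.ne' (hn m).2.ne'

theorem logScale_f3 (h : EventuallyPositive F l) {c d : ℝ} (h1 : LogScale (f1 F l) c)
    (h2 : LogScale (f2 F l) d) : LogScale (f3 F l) (d - c) := by
  refine (h2.sub h1).congr' ?_ EventuallyEq.rfl
  filter_upwards [eventually_f1_eq h] with n hn
  rw [hn]
  ring

theorem logScale_f2 (h : EventuallyPositive F l) {c d : ℝ} (h1 : LogScale (f1 F l) c)
    (h3 : LogScale (f3 F l) d) : LogScale (f2 F l) (d + c) := by
  refine (h3.add h1).congr' ?_ EventuallyEq.rfl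
  filter_upwards [eventually_f1_eq h] with n hn
  rw [hn]
  ring

theorem log_ratio_pos (hb : 0 < b) (hab : b < a) : 0 < Real.log (a / b) :=
  Real.log_pos ((one_lt_div hb).2 hab)

/-- The two rates of the degree threshold `t`, inside and outside the community, differ by the
log-likelihood ratio at `t`. -/
theorem rate_sub_rate (hρ : 0 < ρ) (hb : 0 < b) (hab : b < a) {t : ℝ} (ht : 0 < t) :
    rate (ρ * a) t = rate (ρ * b) t + (ρ * (a - b) - t * Real.log (a / b)) := by
  have ha : 0 < a := hb.trans hab
  rw [rate, rate, Real.log_div ht.ne' (by positivity), Real.log_div ht.ne' (by positivity),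
    Real.log_mul hρ.ne' ha.ne', Real.log_mul hρ.ne' hb.ne', Real.log_div ha.ne' hb.ne']
  ring

theorem rate_outside_eq (hρ : 0 < ρ) (hb : 0 < b) {t : ℝ} (ht : 0 < t) :
    rate (ρ * b) t = ρ * b + t * Real.log (t / (ρ * Real.exp 1 * b)) := by
  rw [rate, Real.log_div ht.ne' (by positivity), Real.log_div ht.ne' (by positivity),
    Real.log_mul hρ.ne' hb.ne', Real.log_mul (by positivity) hb.ne',
    Real.log_mul hρ.ne' (Real.exp_pos 1).ne', Real.log_exp]
  ring

theorem mul_log_div_lt_sub (hb : 0 < b) (hab : b < a) : b * Real.log (a / b) < a - b := by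
  have h := Real.log_lt_sub_one_of_pos (div_pos (hb.trans hab) hb) ((one_lt_div hb).2 hab).ne'
  have := mul_lt_mul_of_pos_left h hb
  rwa [mul_sub, mul_div_cancel₀ _ hb.ne', mul_one] at this

theorem betaMax_pos (hρ : 0 < ρ) (hb : 0 < b) (hab : b < a) : 0 < betaMax ρ a b :=
  mul_pos hρ (by linarith [mul_log_div_lt_sub hb hab])

/-- The logarithmic mean of `a` and `b` is at most their arithmetic mean; it comes from `2 x / (x +
2) ≤ log (1 + x)` at `x = a / b - 1`. -/
theorem two_mul_sub_le_add_mul_log (hb : 0 < b) (hab : b < a) :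
    2 * (a - b) ≤ (a + b) * Real.log (a / b) := by
  have h := Real.le_log_one_add_of_nonneg (sub_nonneg.2 ((one_le_div hb).2 hab.le))
  have h1 : 2 * (a / b - 1) / (a / b - 1 + 2) = 2 * (a - b) / (a + b) := by
    rw [div_sub_one hb.ne', show (a - b) / b + 2 = (a + b) / b by field_simp; ring, ← mul_div_assoc,
      div_div_div_cancel_right₀ hb.ne']
  rw [h1, add_sub_cancel, div_le_iff₀ (by linarith)] at h
  linarith

/-- The degree threshold, on the scale `log n`, belonging to a log-likelihood ratio `γ log n` of the
side information. -/
theorem degree_threshold_mem (hρ : 0 < ρ) (hb : 0 < b) (hab : b < a) {γ : ℝ}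
    (h1 : -betaMax ρ a b < γ) (h2 : γ < betaMax ρ a b) :
    ρ * b < (ρ * (a - b) - γ) / Real.log (a / b) ∧
      (ρ * (a - b) - γ) / Real.log (a / b) < ρ * a := by
  have hT := log_ratio_pos hb hab
  -- The upper bound on `γ` is equivalent to `t > ρ b`. For `t < ρ a`, the lower bound on `γ` gives
  -- `ρ (a - b) - γ < 2 ρ (a - b) - ρ b T`, and the comparison of means bounds this by `ρ a T`.
  have h3 := mul_le_mul_of_nonneg_left (two_mul_sub_le_add_mul_log hb hab) hρ.le
  rw [lt_div_iff₀ hT, div_lt_iff₀ hT]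
  unfold betaMax at h1 h2
  constructor <;> nlinarith

theorem eta2_eq (hρ : 0 < ρ) (hb : 0 < b) (hab : b < a) {γ : ℝ}
    (h1 : -betaMax ρ a b < γ) (h2 : γ < betaMax ρ a b) :
    eta2 ρ a b γ = rate (ρ * b) ((ρ * (a - b) - γ) / Real.log (a / b)) + γ := by
  have ht := (degree_threshold_mem hρ hb hab h1 h2).1
  rw [rate_outside_eq hρ hb ((mul_pos hρ hb).trans ht), eta2, div_div, mul_comm (Real.log (a / b))]

/-- Negative log-likelihood ratios thus fall under the same formula as positive ones. -/
theorem eta3_eq (ρ a b γ : ℝ) : eta3 ρ a b γ = eta2 ρ a b (-γ) + γ := by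
  simp [eta3, eta2]

theorem eta1_eq (hρ : 0 < ρ) : eta1 ρ a b = eta2 ρ a b 0 := by
  unfold eta1 eta2
  have h : (ρ * (a - b) - 0) / (ρ * Real.exp 1 * b * Real.log (a / b)) =
      (a - b) / (Real.exp 1 * b * Real.log (a / b)) := by
    rw [sub_zero, mul_assoc ρ, mul_assoc ρ, mul_div_mul_left _ _ hρ.ne']
  rw [h]
  ring

/-- Every attached threshold is the exponent of the probability that a node with the given outcome
has its degree into the community on the wrong side of `t log n`. -/
theorem OutcomeThreshold.exists_rate (hρ : 0 < ρ) (hb : 0 < b) (hab : b < a)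
    (h : OutcomeThreshold F ρ a b l τ) :
    EventuallyPositive F l ∧ ∃ t d₁ d₂ : ℝ, ρ * b < t ∧ t < ρ * a ∧
      LogScale (f2 F l) (-d₁) ∧ LogScale (f3 F l) (-d₂) ∧
      rate (ρ * a) t + d₁ = τ ∧ rate (ρ * b) t + d₂ = τ := by
  have hB := betaMax_pos hρ hb hab
  have hT := log_ratio_pos hb hab
  -- All six cases are described by `f1 ~ γ log n` and `f2 ~ -δ log n`, with threshold `eta2 ρ a b γ
  -- + δ`. In cases 4 and 6, `δ` is recovered from `f3` through `f2 = f1 + f3`.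
  have main : ∀ {γ δ : ℝ}, EventuallyPositive F l → -betaMax ρ a b < γ → γ < betaMax ρ a b →
      LogScale (f1 F l) γ → LogScale (f2 F l) (-δ) → τ = eta2 ρ a b γ + δ →
      EventuallyPositive F l ∧ ∃ t d₁ d₂ : ℝ, ρ * b < t ∧ t < ρ * a ∧
      LogScale (f2 F l) (-d₁) ∧ LogScale (f3 F l) (-d₂) ∧
      rate (ρ * a) t + d₁ = τ ∧ rate (ρ * b) t + d₂ = τ := by
    intro γ δ hpos h1 h2 hf1 hf2 hτ
    obtain ⟨h3, h4⟩ := degree_threshold_mem hρ hb hab h1 h2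
    have hf3 := logScale_f3 hpos hf1 hf2
    rw [show -δ - γ = -(γ + δ) by ring] at hf3
    refine ⟨hpos, _, δ, γ + δ, h3, h4, hf2, hf3, ?_, ?_⟩
    · rw [rate_sub_rate hρ hb hab ((mul_pos hρ hb).trans h3), hτ, eta2_eq hρ hb hab h1 h2,
        div_mul_cancel₀ _ hT.ne']
      ring
    · rw [hτ, eta2_eq hρ hb hab h1 h2]
      ring
  cases h with
  | case1 hpos h1 h2 h3 =>
    exact main (γ := 0) (δ := 0) hpos (by linarith) hB h1 (by simpa using h2)
      (by rw [eta1_eq hρ, add_zero])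
  | case2 hpos β hβ h1 h2 h3 =>
    exact main (γ := 0) (δ := β) hpos (by linarith) hB h1 h2 (by rw [eta1_eq hρ])
  | case3 hpos β hβ hβ' h1 h2 =>
    exact main (γ := β) (δ := 0) hpos (by linarith) hβ' h1 (by simpa using h2) (add_zero _).symm
  | case4 hpos β hβ hβ' h1 h3 =>
    refine main (γ := -β) (δ := β) hpos (by linarith) (by linarith) h1 ?_ (eta3_eq _ _ _ _)
    simpa using logScale_f2 hpos h1 h3
  | case5 hpos β β' hβ hβ' h1 h2 =>
    exact main (γ := β) (δ := β') hpos (by linarith) hβ' h1 h2 rfl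
  | case6 hpos β β' hβ hβ' h1 h3 =>
    refine main (γ := -β) (δ := β + β') hpos (by linarith) (by linarith) h1 ?_
      (by rw [eta3_eq]; ring)
    have := logScale_f2 hpos h1 h3
    rwa [show -β' + -β = -(β + β') by ring] at this

end Thresholds

/-! ### A threshold below 1 prevents exact recovery. -/

section Necessity

variable {M : ℕ} {L : Fin M → ℕ} {F : Features L} {ρ a b τ : ℝ} {l : ℕ → Outcome L}
  {K : ℕ → ℕ} {p q : ℕ → ℝ}

theorem eventually_exp_le_of_tendsto {x : ℕ → ℝ} {c d : ℝ} (hcd : c < d)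
    (hx : Tendsto (fun n : ℕ => x n / Real.log n) atTop (𝓝 d)) :
    ∀ᶠ n : ℕ in atTop, Real.exp (c * Real.log n) ≤ Real.exp (x n) := by
  filter_upwards [hx.eventually_const_lt hcd, eventually_log_pos] with n h1 h2
  exact Real.exp_le_exp.2 ((lt_div_iff₀ h2).1 h1).le

theorem LogRegime.successProb_le (h : LogRegime ρ a b K p q) (hl : OutcomeThreshold F ρ a b l τ)
    (hτ : τ < 1) (est : (n : ℕ) → Estimator L n) :
    ∀ᶠ n in atTop, successProb F n (K n) (p n) (q n) (est n) ≤ 3 / 4 := by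
  have hρ := h.rho_pos
  have hb := h.b_pos
  have ha : 0 < a := hb.trans h.b_lt_a
  obtain ⟨hpos, t, d₁, d₂, ht1, ht2, hf2, hf3, hr1, hr2⟩ := hl.exists_rate hρ hb h.b_lt_a
  have ht0 : 0 < t := (mul_pos hρ hb).trans ht1
  -- Moving off `t`, down inside and up outside, keeps both exponents below `1` by continuity and
  -- opens the gap `m₁ < m₂`.
  have hs1 : ∀ᶠ s in 𝓝[<] t, rate (ρ * a) s + d₁ < 1 :=
    (((continuousAt_rate (mul_pos hρ ha) ht0).add_const d₁).eventually_lt_const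
      (hr1.trans_lt hτ)).filter_mono nhdsWithin_le_nhds
  have hs2 : ∀ᶠ s in 𝓝[>] t, rate (ρ * b) s + d₂ < 1 :=
    (((continuousAt_rate (mul_pos hρ hb) ht0).add_const d₂).eventually_lt_const
      (hr2.trans_lt hτ)).filter_mono nhdsWithin_le_nhds
  obtain ⟨s₁, hs1r, hs1t, hs1pos⟩ := (hs1.and (eventually_mem_nhdsWithin.and
    (((eventually_gt_nhds ht0)).filter_mono nhdsWithin_le_nhds))).exists
  obtain ⟨s₂, hs2r, hs2t⟩ := (hs2.and eventually_mem_nhdsWithin).exists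
  have hs1t : s₁ < t := hs1t
  have hs2t : t < s₂ := hs2t
  have hs2pos : 0 < s₂ := ht0.trans hs2t
  let m₁ : ℕ → ℕ := fun n => ⌊s₁ * Real.log n⌋₊
  let m₂ : ℕ → ℕ := fun n => ⌊s₂ * Real.log n⌋₊
  have hm : ∀ s : ℝ, 0 < s →
      Tendsto (fun n : ℕ => (⌊s * Real.log n⌋₊ : ℝ) / Real.log n) atTop (𝓝 s) := fun s hs =>
    (tendsto_nat_floor_mul_div_atTop hs.le).comp tendsto_log_natCast
  have hlt : ∀ᶠ n in atTop, m₁ n < m₂ n := by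
    filter_upwards [((hm s₁ hs1pos).eventually_lt_const hs1t),
      ((hm s₂ hs2pos).eventually_const_lt hs2t), eventually_log_pos] with n h1 h2 h3
    have := h1.trans h2
    rw [div_lt_div_iff_of_pos_right h3] at this
    exact_mod_cast this
  -- One `e` each is lost to the number of nodes, the likelihood and the binomial; the fourth makes
  -- the expected counts grow like `n ^ e`.
  obtain ⟨e, he0, he1, he2⟩ : ∃ e > 0, 4 * e < 1 - (rate (ρ * a) s₁ + d₁) ∧
      4 * e < 1 - (rate (ρ * b) s₂ + d₂) := by
    obtain ⟨e, he0, he⟩ := exists_between (lt_min (sub_pos.2 hs1r) (sub_pos.2 hs2r))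
    refine ⟨e / 4, by positivity, ?_, ?_⟩
    · linarith [he.trans_le (min_le_left _ _)]
    · linarith [he.trans_le (min_le_right _ _)]
  have hbin1 := eventually_exp_le_binomial (x := -rate (ρ * a) s₁ - e) (mul_pos hρ ha) hs1pos
    (h.eventually_probs.mono fun n hn => hn.1.trans_le hn.2.1) h.tendsto_p h.tendsto_p_mul_pred
    (hm s₁ hs1pos) (by linarith)
  have hbin2 := eventually_exp_le_binomial (x := -rate (ρ * b) s₂ - e) (mul_pos hρ hb) hs2pos
    h.q_pos h.tendsto_q h.tendsto_q_mul (hm s₂ hs2pos) (by linarith)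
  have hin := eventually_exp_le_of_tendsto (c := -d₁ - e) (by linarith) hf2.tendsto_div
  have hout := eventually_exp_le_of_tendsto (c := -d₂ - e) (by linarith) hf3.tendsto_div
  have hsize := eventually_exp_le_of_tendsto (c := 1 - e) (by linarith) h.tendsto_log_size
  have hlarge : ∀ᶠ n : ℕ in atTop, 16 ≤ Real.exp (e * Real.log n) :=
    (Real.tendsto_exp_atTop.comp
      (tendsto_log_natCast.const_mul_atTop he0)).eventually_ge_atTop 16
  have hc : ∀ᶠ n in atTop, 1 ≤ (1 + 1 / 8) * (1 - p n) ^ 2 := by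
    have h1 : Tendsto (fun n => (1 + 1 / 8 : ℝ) * (1 - p n) ^ 2) atTop
        (𝓝 ((1 + 1 / 8) * (1 - 0) ^ 2)) := ((h.tendsto_p.const_sub 1).pow 2).const_mul _
    exact (h1.eventually_const_lt (by norm_num)).mono fun n hn => hn.le
  -- This lets the lower bound for the community size serve for its complement as well.
  have hhalf : ∀ᶠ n : ℕ in atTop, (K n : ℝ) ≤ n - K n := by
    filter_upwards [h.tendsto_size_div.eventually_lt_const (show (0 : ℝ) < 1 / 2 by norm_num),
      eventually_gt_atTop 0] with n h1 h2
    have h3 : (0 : ℝ) < n := by exact_mod_cast h2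
    rw [div_lt_iff₀ h3] at h1
    linarith
  filter_upwards [h.eventually_probs, h.eventually_size_le, hlt, hc, hbin1, hbin2, hin, hout, hsize,
    hlarge, hhalf, eventually_exp_f2_eq hpos, eventually_exp_f3_eq hpos, eventually_log_pos,
    h.tendsto_size.eventually_gt_atTop 0] with
    n ⟨hq0, hqp, hp1⟩ hKn hlt hc hbin1 hbin2 hin hout hsize hlarge hhalf hf2 hf3 hlog hK0
  rw [← hf2] at hin
  rw [← hf3] at hout
  rw [Real.exp_log hK0] at hsize
  have key : ∀ {r d u v w : ℝ}, 4 * e < 1 - (r + d) →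
      Real.exp ((-r - e) * Real.log n) ≤ u → Real.exp ((-d - e) * Real.log n) ≤ v →
      Real.exp ((1 - e) * Real.log n) ≤ w → 16 ≤ w * (v * u) := by
    intro r d u v w hrd hu hv hw
    calc (16 : ℝ) ≤ Real.exp (e * Real.log n) := hlarge
      _ ≤ Real.exp ((1 - e) * Real.log n + ((-d - e) * Real.log n + (-r - e) * Real.log n)) := by
          refine Real.exp_le_exp.2 ?_
          nlinarith
      _ ≤ _ := by
          rw [Real.exp_add, Real.exp_add]
          have hv0 := (Real.exp_pos _).le.trans hv
          have hw0 := (Real.exp_pos _).le.trans hw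
          gcongr
  -- These values give `(1 + (1/16 + 1/8 + 1/16)) / 2 = 5/8`.
  refine (successProb_le_of_many hq0 hqp hp1 hKn (est n) (l n) hlt (c := 1 / 8) (x := 16)
    (by norm_num) hc (by norm_num) ?_ ?_).trans (by norm_num)
  · exact key he1 hbin1 hin hsize
  · exact key he2 hbin2 hout (hsize.trans hhalf)

end Necessity

/-! ### Thresholds above 1 give exact recovery by degree tests. -/

section Sufficiency

variable {M : ℕ} {L : Fin M → ℕ} {F : Features L} {ρ a b τ : ℝ}
  {K : ℕ → ℕ} {p q : ℕ → ℝ}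

theorem log_div_neg_of_lt {s c : ℝ} (hs : 0 < s) (h : s < c) : Real.log (s / c) < 0 :=
  Real.log_neg (div_pos hs (hs.trans h)) ((div_lt_one (hs.trans h)).2 h)

/-- A test that compares the degree with a multiple of `log n` fails at some community node with
vanishing probability when the exponent of the failure probability exceeds `1`. -/
theorem LogRegime.inside_test (h : LogRegime ρ a b K p q) {o : Outcome L} {s d : ℝ}
    (hpos : EventuallyPositive F fun _ => o) (hf : LogScale (f2 F fun _ => o) (-d)) (hs : 0 < s)
    (hsa : s < ρ * a) (hr : 1 < rate (ρ * a) s + d) :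
    ∃ β : ℕ → ℝ, Tendsto β atTop (𝓝 0) ∧ ∀ᶠ n in atTop, ∀ C : Finset (Fin n), C.card = K n →
      ∀ i ∈ C, n * (insideLik F n o * wprob (graphProb (p n) (q n) C)
        fun G => ¬ s * Real.log n ≤ degIn G i C) ≤ β n := by
  have hc : 0 < ρ * a := hs.trans hsa
  -- The optimal Chernoff tilt, negative because the lower tail is bounded; it produces exactly
  -- `rate (ρ * a) s`.
  set t := Real.log (s / (ρ * a)) with ht
  have ht0 : t < 0 := log_div_neg_of_lt hs hsa
  have hexp : Real.exp t = s / (ρ * a) := Real.exp_log (div_pos hs hc)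
  refine ⟨fun n => Real.exp (Real.log n + f2 F (fun _ => o) n +
    ((s / (ρ * a) - 1) * (p n * ((K n - 1 : ℕ) : ℝ)) - t * (s * Real.log n))), ?_, ?_⟩
  · refine tendsto_exp_of_div_log (c := 1 - rate (ρ * a) s - d) (by linarith) ?_
    have h1 := (hf.tendsto_div.const_add 1).add
      ((h.tendsto_p_mul_pred.const_mul (s / (ρ * a) - 1)).sub_const (t * s))
    have h2 : 1 + -d + ((s / (ρ * a) - 1) * (ρ * a) - t * s) = 1 - rate (ρ * a) s - d := by
      rw [rate, ← ht, sub_mul, div_mul_cancel₀ _ hc.ne']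
      ring
    rw [h2] at h1
    refine h1.congr' ?_
    filter_upwards [eventually_log_pos] with n hn
    field_simp
  · filter_upwards [h.eventually_probs, eventually_exp_f2_eq hpos, eventually_gt_atTop 0] with
      n ⟨hq0, hqp, hp1⟩ hf2 hn C hC i hi
    have hn0 : (0 : ℝ) < n := by exact_mod_cast hn
    have hp0 : 0 ≤ p n := hq0.le.trans hqp
    have hq1 : q n ≤ 1 := hqp.trans hp1.le
    have hch := wprob_degIn_le (C := C) (t := t) (x := s * Real.log n) hp0 hp1.le hq0.le hq1
      (Finset.notMem_erase i C) hp0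
      (fun k hk => by simp [edgeProb, hi, Finset.mem_of_mem_erase hk])
    rw [hexp, Finset.card_erase_of_mem hi, hC] at hch
    have hle : wprob (graphProb (p n) (q n) C) (fun G => ¬ s * Real.log n ≤ degIn G i C) ≤ _ :=
      (wprob_mono (graphProb_nonneg hp0 hp1.le hq0.le hq1) fun G hG => ?_).trans hch
    · rw [Real.exp_add, Real.exp_add, Real.exp_log hn0, ← hf2, mul_assoc]
      exact mul_le_mul_of_nonneg_left (mul_le_mul_of_nonneg_left hle (insideLik_nonneg o)) hn0.le
    · refine mul_le_mul_of_nonpos_left ?_ ht0.le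
      refine le_trans ?_ (not_le.1 hG).le
      exact_mod_cast degIn_mono G i (Finset.erase_subset _ _)

/-- The mirror image of `LogRegime.inside_test`: the upper tail, with the positive tilt `log (s / (ρ
b))`. -/
theorem LogRegime.outside_test (h : LogRegime ρ a b K p q) {o : Outcome L} {s d : ℝ}
    (hpos : EventuallyPositive F fun _ => o) (hf : LogScale (f3 F fun _ => o) (-d))
    (hsb : ρ * b < s) (hr : 1 < rate (ρ * b) s + d) :
    ∃ β : ℕ → ℝ, Tendsto β atTop (𝓝 0) ∧ ∀ᶠ n in atTop, ∀ C : Finset (Fin n), C.card = K n →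
      ∀ i ∉ C, n * (outsideLik F n o * wprob (graphProb (p n) (q n) C)
        fun G => ¬ degIn G i C ≤ s * Real.log n) ≤ β n := by
  have hc : 0 < ρ * b := mul_pos h.rho_pos h.b_pos
  have hs : 0 < s := hc.trans hsb
  set t := Real.log (s / (ρ * b)) with ht
  have ht0 : 0 < t := Real.log_pos ((one_lt_div hc).2 hsb)
  have hexp : Real.exp t = s / (ρ * b) := Real.exp_log (div_pos hs hc)
  refine ⟨fun n => Real.exp (Real.log n + f3 F (fun _ => o) n +
    ((s / (ρ * b) - 1) * (q n * K n) - t * (s * Real.log n))), ?_, ?_⟩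
  · refine tendsto_exp_of_div_log (c := 1 - rate (ρ * b) s - d) (by linarith) ?_
    have h1 := (hf.tendsto_div.const_add 1).add
      ((h.tendsto_q_mul.const_mul (s / (ρ * b) - 1)).sub_const (t * s))
    have h2 : 1 + -d + ((s / (ρ * b) - 1) * (ρ * b) - t * s) = 1 - rate (ρ * b) s - d := by
      rw [rate, ← ht, sub_mul, div_mul_cancel₀ _ hc.ne']
      ring
    rw [h2] at h1
    refine h1.congr' ?_
    filter_upwards [eventually_log_pos] with n hn
    field_simp
  · filter_upwards [h.eventually_probs, eventually_exp_f3_eq hpos, eventually_gt_atTop 0] with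
      n ⟨hq0, hqp, hp1⟩ hf3 hn C hC i hi
    have hn0 : (0 : ℝ) < n := by exact_mod_cast hn
    have hp0 : 0 ≤ p n := hq0.le.trans hqp
    have hq1 : q n ≤ 1 := hqp.trans hp1.le
    have hch := wprob_degIn_le (C := C) (t := t) (x := s * Real.log n) hp0 hp1.le hq0.le hq1
      hi hq0.le (fun k hk => by simp [edgeProb, hi])
    rw [hexp, hC] at hch
    have hle : wprob (graphProb (p n) (q n) C) (fun G => ¬ degIn G i C ≤ s * Real.log n) ≤ _ :=
      (wprob_mono (graphProb_nonneg hp0 hp1.le hq0.le hq1) fun G hG =>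
        mul_le_mul_of_nonneg_left (not_le.1 hG).le ht0.le).trans hch
    rw [Real.exp_add, Real.exp_add, Real.exp_log hn0, ← hf3, mul_assoc]
    exact mul_le_mul_of_nonneg_left (mul_le_mul_of_nonneg_left hle (outsideLik_nonneg o)) hn0.le

/-- With high probability no wrong set agrees with the data, for tests that are separated on the
scale `log n`. -/
theorem LogRegime.uniqueness (h : LogRegime ρ a b K p q) {Pin Pout : ℕ → Outcome L → ℕ → Prop}
    {ε : ℝ} (hε : 0 < ε)
    (hsep : ∀ᶠ n : ℕ in atTop, ∀ o (e e' : ℕ), Pin n o e → Pout n o e' →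
      (e' : ℝ) + 2 * ε * Real.log n ≤ e ∧ (ρ * b + ε) * Real.log n ≤ e) :
    ∃ β : ℕ → ℝ, Tendsto β atTop (𝓝 0) ∧ ∀ᶠ n in atTop, ∀ C : Finset (Fin n), C.card = K n →
      wprob (modelProb F (p n) (q n) C) (fun ω => Consistent (Pin n) (Pout n) ω.1 ω.2 C ∧
        ∃ D : Finset (Fin n), D.card = K n ∧ D ≠ C ∧ Consistent (Pin n) (Pout n) ω.1 ω.2 D) ≤
      β n := by
  have hc : 0 < ρ * b := mul_pos h.rho_pos h.b_pos
  have hρ0 := h.rho_pos.ne'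
  have hb0 := h.b_pos.ne'
  -- Chosen so that the Chernoff gain is `4 log n` for each node of `D \ C`.
  let t₁ := 2 / ε
  have ht₁ : 0 < t₁ := by positivity
  let A := (Real.exp (2 * t₁) - 1) / 2
  have hA : 0 < A := by
    have := Real.add_one_lt_exp (mul_pos two_pos ht₁).ne'
    have : 0 < 2 * t₁ := by positivity
    simp only [A]
    linarith
  -- For `k ≤ κ K` the moment term is then at most `log n` per node, as `q K ≤ 2 ρ b log n`
  -- eventually. Another `log n` per node pays for choosing the set, which leaves `-2 log n` per
  -- node.
  let κ := 1 / (A * (2 * (ρ * b)))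
  have hκ : 0 < κ := by positivity
  -- Half the optimal tilt, since a pair may be counted in both orders. The exponent is then half
  -- the rate, `-2 c log n` per node.
  let t₂ := Real.log ((ρ * b + ε) / (ρ * b)) / 2
  have ht₂ : 0 < t₂ := by
    have := Real.log_pos ((one_lt_div hc).2 (show ρ * b < ρ * b + ε by linarith))
    positivity
  have hexp₂ : Real.exp (2 * t₂) = (ρ * b + ε) / (ρ * b) := by
    rw [mul_div_cancel₀ _ two_ne_zero, Real.exp_log (by positivity)]
  let c := rate (ρ * b) (ρ * b + ε) / 4
  have hcpos : 0 < c := div_pos (rate_pos hc (by linarith) (by linarith)) (by norm_num)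
  have hlim₂ : Tendsto (fun n => ((Real.exp (2 * t₂) - 1) / 2 * (q n * K n) -
      t₂ * ((ρ * b + ε) * Real.log n)) / Real.log n) atTop (𝓝 (-(2 * c))) := by
    have h1 := (h.tendsto_q_mul.const_mul ((Real.exp (2 * t₂) - 1) / 2)).sub_const
      (t₂ * (ρ * b + ε))
    have h2 : (Real.exp (2 * t₂) - 1) / 2 * (ρ * b) - t₂ * (ρ * b + ε) = -(2 * c) := by
      rw [hexp₂]
      simp only [c, rate, t₂]
      field_simp
      ring
    rw [h2] at h1
    refine h1.congr' ?_
    filter_upwards [eventually_log_pos] with n hn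
    field_simp
  have hlarge : Tendsto (fun n => Real.exp (-(c * κ / 2) * (K n * Real.log n))) atTop (𝓝 0) := by
    refine Real.tendsto_exp_atBot.comp ?_
    refine Tendsto.const_mul_atTop_of_neg (by have : 0 < c * κ := by positivity
                                              linarith) ?_
    exact h.tendsto_size.atTop_mul_atTop₀ tendsto_log_natCast
  have hsmall : Tendsto (fun n : ℕ => κ * Real.exp (-Real.log n)) atTop (𝓝 0) := by
    have := (Real.tendsto_exp_neg_atTop_nhds_zero.comp tendsto_log_natCast).const_mul κ
    simpa using this
  -- For more than `κ K` wrong nodes the gain is at least `c κ K log n`, and the number of candidate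
  -- sets costs at most half of it.
  have hentropy : Tendsto (fun n : ℕ => (1 + Real.log (n / K n)) / Real.log n) atTop (𝓝 0) := by
    have h1 := (tendsto_const_nhds (x := (1 : ℝ))).div_atTop tendsto_log_natCast |>.add
      h.tendsto_log_div_size
    rw [add_zero] at h1
    exact h1.congr fun n => (add_div _ _ _).symm
  have hsum := hsmall.add hlarge
  rw [add_zero] at hsum
  refine ⟨_, hsum, ?_⟩
  filter_upwards [hsep, h.eventually_probs, h.eventually_size_le, eventually_log_pos,
    h.tendsto_size.eventually_gt_atTop 0,
    h.tendsto_q_mul.eventually_lt_const (show ρ * b < 2 * (ρ * b) by linarith),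
    hlim₂.eventually_lt_const (show -(2 * c) < -c by linarith),
    hentropy.eventually_lt_const (show 0 < c * κ / 2 by positivity), eventually_gt_atTop 0] with
    n hsep ⟨hq0, hqp, hp1⟩ hKn hlog hK0 hqK hneg hent hn C hC
  have hn0 : (0 : ℝ) < n := by exact_mod_cast hn
  have hp0 : 0 ≤ p n := hq0.le.trans hqp
  have hq1 : q n ≤ 1 := hqp.trans hp1.le
  rw [div_lt_iff₀ hlog] at hqK hneg hent
  refine (wprob_exists_consistent_le (F := F) hp0 hp1.le hq0.le hq1 hsep hC ⌊κ * K n⌋₊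
    (t₁ := t₁) (t₂ := t₂) (X := -(c * κ * (K n * Real.log n))) ht₁.le ht₂.le ?_).trans
    (add_le_add ?_ ?_)
  · intro k hk
    have hk' : κ * K n < k := (Nat.floor_lt (by positivity)).1 hk
    calc _ = ((Real.exp (2 * t₂) - 1) / 2 * (q n * K n) -
          t₂ * ((ρ * b + ε) * Real.log n)) * k := by ring
      _ ≤ -c * Real.log n * k := by gcongr
      _ ≤ -c * Real.log n * (κ * K n) := by
          refine mul_le_mul_of_nonpos_left hk'.le ?_
          nlinarith
      _ = _ := by ring
  · have hterm : ∀ k ∈ Finset.Icc 1 ⌊κ * K n⌋₊, (n.choose k : ℝ) *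
        Real.exp ((Real.exp (2 * t₁) - 1) / 2 * (q n * (k * k)) -
          t₁ * (2 * ε * Real.log n * k)) ≤ Real.exp (-(2 * Real.log n)) := by
      intro k hk
      rw [Finset.mem_Icc] at hk
      have hk1 : (1 : ℝ) ≤ k := by exact_mod_cast hk.1
      have hk2 : (k : ℝ) ≤ κ * K n := (Nat.le_floor_iff (by positivity)).1 hk.2
      have hch : (n.choose k : ℝ) ≤ Real.exp (k * Real.log n) := by
        rw [Real.exp_nat_mul, Real.exp_log hn0]
        exact_mod_cast Nat.choose_le_pow n k
      refine (mul_le_mul_of_nonneg_right hch (Real.exp_pos _).le).trans ?_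
      rw [← Real.exp_add]
      refine Real.exp_le_exp.2 ?_
      have h1 : A * (q n * k) ≤ Real.log n := by
        calc A * (q n * k) ≤ A * (q n * (κ * K n)) := by gcongr
          _ = A * κ * (q n * K n) := by ring
          _ ≤ A * κ * (2 * (ρ * b) * Real.log n) := by gcongr
          _ = Real.log n := by
            simp only [κ]
            field_simp
      have h2 : t₁ * (2 * ε * Real.log n * k) = 4 * Real.log n * k := by
        simp only [t₁]
        field_simp
        ring
      have h3 : (Real.exp (2 * t₁) - 1) / 2 * (q n * (k * k)) = A * (q n * k) * k := by
        simp only [A]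
        ring
      rw [h2, h3]
      nlinarith [mul_le_mul_of_nonneg_right h1 (by linarith : (0 : ℝ) ≤ k)]
    refine (Finset.sum_le_card_nsmul _ _ _ hterm).trans ?_
    rw [Nat.card_Icc, Nat.add_sub_cancel, nsmul_eq_mul]
    calc (⌊κ * K n⌋₊ : ℝ) * Real.exp (-(2 * Real.log n)) ≤
          κ * n * Real.exp (-(2 * Real.log n)) := by
          gcongr
          refine (Nat.floor_le (by positivity)).trans ?_
          gcongr
      _ = κ * (Real.exp (Real.log n) * Real.exp (-(2 * Real.log n))) := by
          rw [Real.exp_log hn0]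
          ring
      _ = κ * Real.exp (-Real.log n) := by
          rw [← Real.exp_add]
          ring_nf
  · have hK0' : 0 < K n := by exact_mod_cast hK0
    refine (mul_le_mul_of_nonneg_right (choose_le_exp hK0' hKn) (Real.exp_pos _).le).trans ?_
    rw [← Real.exp_add]
    refine Real.exp_le_exp.2 ?_
    have := mul_le_mul_of_nonneg_left hent.le hK0.le
    linarith

/-- The factor `n` in `hin` and `hout` pays for the union bound over nodes. The outcomes are finite
in number, independently of `n`, so their errors still add up to `o(1)`. -/
theorem exactRecovery_of_tests (h : LogRegime ρ a b K p q) {Pin Pout : ℕ → Outcome L → ℕ → Prop}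
    {ε : ℝ} (hε : 0 < ε)
    (hsep : ∀ᶠ n : ℕ in atTop, ∀ o (e e' : ℕ), Pin n o e → Pout n o e' →
      (e' : ℝ) + 2 * ε * Real.log n ≤ e ∧ (ρ * b + ε) * Real.log n ≤ e)
    (hin : ∀ o, ∃ β : ℕ → ℝ, Tendsto β atTop (𝓝 0) ∧ ∀ᶠ n in atTop, ∀ C : Finset (Fin n),
      C.card = K n → ∀ i ∈ C, n * (insideLik F n o * wprob (graphProb (p n) (q n) C)
        fun G => ¬ Pin n o (degIn G i C)) ≤ β n)
    (hout : ∀ o, ∃ β : ℕ → ℝ, Tendsto β atTop (𝓝 0) ∧ ∀ᶠ n in atTop, ∀ C : Finset (Fin n),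
      C.card = K n → ∀ i ∉ C, n * (outsideLik F n o * wprob (graphProb (p n) (q n) C)
        fun G => ¬ Pout n o (degIn G i C)) ≤ β n) :
    ExactRecovery F K p q := by
  refine ⟨fun n => consistentEstimator (Pin n) (Pout n) n (K n), ?_⟩
  obtain ⟨β, hβ, hβle⟩ := h.uniqueness (F := F) hε hsep
  choose β₁ hβ₁ hβ₁le using hin
  choose β₂ hβ₂ hβ₂le using hout
  have hlow : Tendsto (fun n => 1 - (∑ o, |β₁ o n| + ∑ o, |β₂ o n|) - β n) atTop (𝓝 1) := by
    have h1 := tendsto_finsetSum Finset.univ fun o _ => (hβ₁ o).abs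
    have h2 := tendsto_finsetSum Finset.univ fun o _ => (hβ₂ o).abs
    have h3 := ((h1.add h2).const_sub 1).sub hβ
    simpa using h3
  refine tendsto_of_tendsto_of_tendsto_of_le_of_le' hlow tendsto_const_nhds ?_ ?_
  · filter_upwards [hβle, eventually_all.2 hβ₁le, eventually_all.2 hβ₂le, h.eventually_probs,
      h.eventually_size_le, eventually_gt_atTop 0] with n hu h1 h2 ⟨hq0, hqp, hp1⟩ hKn hn
    have hn0 : (0 : ℝ) < n := by exact_mod_cast hn
    have hp0 : 0 ≤ p n := hq0.le.trans hqp
    have hq1 : q n ≤ 1 := hqp.trans hp1.le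
    have hg := fun C : Finset (Fin n) => graphProb_nonneg (C := C) hp0 hp1.le hq0.le hq1
    refine le_successProb hKn fun C hC => ?_
    refine le_trans ?_ (le_wprob_consistentEstimator hp0 hp1.le hq0.le hq1 _ _ hC)
    refine sub_le_sub (sub_le_sub_left ?_ _) (hu C hC)
    have hsum : ∀ (S : Finset (Fin n)) (f : Fin n → Outcome L → ℝ) (g : Outcome L → ℝ),
        (∀ i ∈ S, ∀ o, 0 ≤ f i o) → (∀ i ∈ S, ∀ o, n * f i o ≤ g o) → (∀ o, 0 ≤ g o) →
        ∑ i ∈ S, ∑ o, f i o ≤ ∑ o, g o := by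
      intro S f g hf hfg hg0
      have hcard : (S.card : ℝ) ≤ n := by
        have := Finset.card_le_univ S
        rw [Fintype.card_fin] at this
        exact_mod_cast this
      calc ∑ i ∈ S, ∑ o, f i o ≤ ∑ i ∈ S, ∑ o, g o / n :=
            Finset.sum_le_sum fun i hi => Finset.sum_le_sum fun o _ => by
              rw [le_div_iff₀ hn0, mul_comm]
              exact hfg i hi o
        _ = S.card * ((∑ o, g o) / n) := by
            rw [Finset.sum_const, nsmul_eq_mul, Finset.sum_div]
        _ ≤ n * ((∑ o, g o) / n) := by
            have := Finset.sum_nonneg fun o (_ : o ∈ Finset.univ) => hg0 o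
            gcongr
        _ = _ := by field_simp
    refine (wprob_not_consistent_le hp0 hp1.le hq0.le hq1 _ _).trans (add_le_add ?_ ?_)
    · exact hsum _ _ _ (fun i _ o => mul_nonneg (insideLik_nonneg o) (wprob_nonneg (hg C)))
        (fun i hi o => (h1 o C hC i hi).trans (le_abs_self _)) fun o => abs_nonneg _
    · exact hsum _ _ _ (fun i _ o => mul_nonneg (outsideLik_nonneg o) (wprob_nonneg (hg C)))
        (fun i hi o => (h2 o C hC i (Finset.mem_compl.1 hi)).trans (le_abs_self _))
        fun o => abs_nonneg _
  · filter_upwards [h.eventually_probs] with n ⟨hq0, hqp, hp1⟩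
    exact successProb_le_one (hq0.le.trans hqp) hp1.le hq0.le (hqp.trans hp1.le) _ _

/-- What a regular outcome needs from the tests: some degree threshold `t` works with margin `ε`. -/
theorem OutcomeThreshold.eventually_margin (hρ : 0 < ρ) (hb : 0 < b) (hab : b < a)
    {l : ℕ → Outcome L} (h : OutcomeThreshold F ρ a b l τ) (hτ : 1 < τ) :
    EventuallyPositive F l ∧ ∃ t d₁ d₂ : ℝ, LogScale (f2 F l) (-d₁) ∧ LogScale (f3 F l) (-d₂) ∧
      ∀ᶠ ε in 𝓝[>] (0 : ℝ), ρ * b < t - ε ∧ t + ε < ρ * a ∧ 1 < rate (ρ * a) (t + ε) + d₁ ∧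
        1 < rate (ρ * b) (t - ε) + d₂ := by
  obtain ⟨hpos, t, d₁, d₂, h1, h2, h3, h4, h5, h6⟩ := h.exists_rate hρ hb hab
  have ht0 : 0 < t := (mul_pos hρ hb).trans h1
  refine ⟨hpos, t, d₁, d₂, h3, h4, Eventually.filter_mono nhdsWithin_le_nhds ?_⟩
  have hadd : Tendsto (fun ε : ℝ => t + ε) (𝓝 0) (𝓝 t) := by
    simpa using (tendsto_id (x := 𝓝 (0 : ℝ))).const_add t
  have hsub : Tendsto (fun ε : ℝ => t - ε) (𝓝 0) (𝓝 t) := by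
    simpa using (tendsto_id (x := 𝓝 (0 : ℝ))).const_sub t
  have hr1 := (((continuousAt_rate (mul_pos hρ (hb.trans hab)) ht0).tendsto.comp hadd).add_const
    d₁).eventually_const_lt (hτ.trans_eq h5.symm)
  have hr2 := (((continuousAt_rate (mul_pos hρ hb) ht0).tendsto.comp hsub).add_const
    d₂).eventually_const_lt (hτ.trans_eq h6.symm)
  filter_upwards [hsub.eventually_const_lt h1, hadd.eventually_lt_const h2, hr1, hr2] with
    ε e1 e2 e3 e4
  exact ⟨e1, e2, e3, e4⟩

theorem SuperpolynomiallyRare.eventually_min_le {o : Outcome L} (h : SuperpolynomiallyRare F o) :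
    ∀ᶠ n : ℕ in atTop, n * min (insideLik F n o) (outsideLik F n o) ≤ (n : ℝ)⁻¹ := by
  filter_upwards [h 2, eventually_gt_atTop 0] with n hn hn0
  have hn0 : (0 : ℝ) < n := by exact_mod_cast hn0
  refine (mul_le_mul_of_nonneg_left hn hn0.le).trans (le_of_eq ?_)
  rw [Real.rpow_neg hn0.le, Real.rpow_two]
  field_simp

/-- Since there are finitely many outcomes, one margin `ε` serves all regular ones; only constant
sequences of outcomes enter. -/
theorem LogRegime.exactRecovery (h : LogRegime ρ a b K p q) (hcl : OutcomesClassified F ρ a b)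
    (hτ : ∀ (l : ℕ → Outcome L) (τ : ℝ), OutcomeThreshold F ρ a b l τ → 1 < τ) :
    ExactRecovery F K p q := by
  classical
  have hρ := h.rho_pos
  have hb := h.b_pos
  let R : Outcome L → Prop := fun o => ∃ τ, OutcomeThreshold F ρ a b (fun _ => o) τ
  have hmargin : ∀ o, ∃ t d₁ d₂ : ℝ, R o → EventuallyPositive F (fun _ => o) ∧
      LogScale (f2 F fun _ => o) (-d₁) ∧ LogScale (f3 F fun _ => o) (-d₂) ∧
      ∀ᶠ ε in 𝓝[>] (0 : ℝ), ρ * b < t - ε ∧ t + ε < ρ * a ∧ 1 < rate (ρ * a) (t + ε) + d₁ ∧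
        1 < rate (ρ * b) (t - ε) + d₂ := by
    intro o
    by_cases ho : R o
    · obtain ⟨τ, hoτ⟩ := ho
      obtain ⟨h0, t, d₁, d₂, h1, h2, h3⟩ := hoτ.eventually_margin hρ hb h.b_lt_a (hτ _ _ hoτ)
      exact ⟨t, d₁, d₂, fun _ => ⟨h0, h1, h2, h3⟩⟩
    · exact ⟨0, 0, 0, fun h => absurd h ho⟩
  choose t d₁ d₂ hreg using hmargin
  have hall : ∀ᶠ ε in 𝓝[>] (0 : ℝ), ∀ o, R o → ρ * b < t o - ε ∧ t o + ε < ρ * a ∧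
      1 < rate (ρ * a) (t o + ε) + d₁ o ∧ 1 < rate (ρ * b) (t o - ε) + d₂ o := by
    refine eventually_all.2 fun o => ?_
    by_cases ho : R o
    · exact (hreg o ho).2.2.2.mono fun ε hε _ => hε
    · exact Eventually.of_forall fun ε h => absurd h ho
  obtain ⟨ε, hε, hε0⟩ := (hall.and eventually_mem_nhdsWithin).exists
  have hε0 : 0 < ε := hε0
  -- For a rare outcome the tests ignore the degree and are complementary, so separation holds
  -- vacuously. They fail only under the less likely label, hence with probability `min (insideLik F
  -- n o) (outsideLik F n o)` at most.
  let Pin : ℕ → Outcome L → ℕ → Prop := fun n o e =>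
    if R o then (t o + ε) * Real.log n ≤ e else ¬ insideLik F n o ≤ outsideLik F n o
  let Pout : ℕ → Outcome L → ℕ → Prop := fun n o e =>
    if R o then e ≤ (t o - ε) * Real.log n else insideLik F n o ≤ outsideLik F n o
  have hinv : Tendsto (fun n : ℕ => (n : ℝ)⁻¹) atTop (𝓝 0) := tendsto_inv_atTop_nhds_zero_nat
  refine exactRecovery_of_tests (Pin := Pin) (Pout := Pout) h hε0 ?_ (fun o => ?_) fun o => ?_
  · filter_upwards [eventually_log_pos] with n hn o e e' h1 h2
    by_cases ho : R o
    · simp only [Pin, Pout, ho, if_true] at h1 h2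
      have := (hε o ho).1
      constructor <;> nlinarith
    · simp only [Pin, Pout, ho, if_false] at h1 h2
      exact absurd h2 h1
  · by_cases ho : R o
    · simp only [Pin, ho, if_true]
      obtain ⟨e1, e2, e3, -⟩ := hε o ho
      exact h.inside_test (hreg o ho).1 (hreg o ho).2.1
        (by linarith [mul_pos hρ hb]) e2 e3
    · simp only [Pin, ho, if_false, not_not]
      refine ⟨_, hinv, ?_⟩
      filter_upwards [((hcl o).resolve_left ho).eventually_min_le, h.eventually_probs] with
        n hn ⟨hq0, hqp, hp1⟩ C hC i hi
      refine le_trans (mul_le_mul_of_nonneg_left ?_ (Nat.cast_nonneg n)) hn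
      by_cases hle : insideLik F n o ≤ outsideLik F n o
      · rw [min_eq_left hle]
        exact mul_le_of_le_one_right (insideLik_nonneg o) (wprob_le_one (graphProb_nonneg
          (hq0.le.trans hqp) hp1.le hq0.le (hqp.trans hp1.le)) sum_graphProb)
      · simp only [hle, wprob, if_false, Finset.sum_const_zero, mul_zero]
        exact le_min (insideLik_nonneg o) (outsideLik_nonneg o)
  · by_cases ho : R o
    · simp only [Pout, ho, if_true]
      obtain ⟨e1, e2, -, e4⟩ := hε o ho
      exact h.outside_test (hreg o ho).1 (hreg o ho).2.2.1 e1 e4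
    · simp only [Pout, ho, if_false]
      refine ⟨_, hinv, ?_⟩
      filter_upwards [((hcl o).resolve_left ho).eventually_min_le, h.eventually_probs] with
        n hn ⟨hq0, hqp, hp1⟩ C hC i hi
      refine le_trans (mul_le_mul_of_nonneg_left ?_ (Nat.cast_nonneg n)) hn
      by_cases hle : insideLik F n o ≤ outsideLik F n o
      · simp only [hle, not_true_eq_false, wprob, if_false, Finset.sum_const_zero, mul_zero]
        exact le_min (insideLik_nonneg o) (outsideLik_nonneg o)
      · rw [min_eq_right (not_le.1 hle).le]
        exact mul_le_of_le_one_right (outsideLik_nonneg o) (wprob_le_one (graphProb_nonneg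
          (hq0.le.trans hqp) hp1.le hq0.le (hqp.trans hp1.le)) sum_graphProb)

end Sufficiency

theorem theorem4 {M : ℕ} {L : Fin M → ℕ} (F : Features L) (ρ a b : ℝ)
    (hρ : 0 < ρ) (hρ1 : ρ < 1) (hb : 0 < b) (hab : b < a)
    (K : ℕ → ℕ) (p q : ℕ → ℝ)
    (hK : ∀ᶠ n : ℕ in atTop, |(K n : ℝ) - ρ * n / Real.log n| < 1)
    (hp : ∀ᶠ n : ℕ in atTop, p n = a * Real.log n ^ 2 / n)
    (hq : ∀ᶠ n : ℕ in atTop, q n = b * Real.log n ^ 2 / n) :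
    (ExactRecovery F K p q →
      ∀ (l : ℕ → Outcome L) (τ : ℝ), OutcomeThreshold F ρ a b l τ → 1 ≤ τ) ∧
    (OutcomesClassified F ρ a b →
      (∀ (l : ℕ → Outcome L) (τ : ℝ), OutcomeThreshold F ρ a b l τ → 1 < τ) →
      ExactRecovery F K p q) := by
  have h := LogRegime.of_eventually hρ hb hab hK hp hq
  refine ⟨?_, h.exactRecovery⟩
  rintro ⟨est, hest⟩ l τ hl
  by_contra hτ
  obtain ⟨n, h1, h2⟩ := ((h.successProb_le hl (not_le.1 hτ) est).and
    (hest.eventually_const_lt (show (3 / 4 : ℝ) < 1 by norm_num))).exists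
  exact absurd h1 (not_le.2 h2)
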